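/- **Conventions.** An *operator space* is a complete matrix normed complex vector space satisfying Ruan's axioms. An *operator algebra* is a norm-closed (not necessarily unital) subalgebra $A\subseteq B(H)$, $H$ a complex Hilbert space, that contains a contractive two-sided approximate identity; $M_n(A)\subseteq M_n(B(H))=B(H^n)$ carries the operator norm. A *non-degenerate right operator $A$-module* is an operator space $E$ with a right $A$-module structure (compatible with the complex scalars) such that the induced map $E\otimes_h A\to E$ on the Haagerup tensor product is completely contractive and the elements $x\cdot a$ ($x\in E$, $a\in A$) span a dense subspace of $E$. Let $\mathrm{OMOD}_A^\infty$ be the category of these modules with the completely bounded $A$-module maps as morphisms, let $\mathrm{Op}^\infty$ be the category of operator spaces with the completely bounded linear maps, and let $U\colon \mathrm{OMOD}_A^\infty\to\mathrm{Op}^\infty$ be the forgetful functor. In an additive category, a *kernel–cokernel pair* is a composable pair $(\mu,\pi)$ such that $\mu$ is a kernel of $\pi$ and $\pi$ is a cokernel of $\mu$. It is *split* if there are morphisms $r,s$ in the opposite directions with $r\mu=\mathrm{id}$, $\pi s=\mathrm{id}$ and $\mu r+s\pi=\mathrm{id}$. An *exact structure* is a class $\mathcal E$ of kernel–cokernel pairs,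 closed under isomorphisms, such that, calling first components of pairs in $\mathcal E$ admissible monomorphisms and second components admissible epimorphisms: all identities are admissible monomorphisms and admissible epimorphisms; admissible monomorphisms and admissible epimorphisms are each closed under composition; the pushout of an admissible monomorphism along any morphism exists and yields an admissible monomorphism; the pullback of an admissible epimorphism along any morphism exists and yields an admissible epimorphism. An *exact category* is an additive category together with an exact structure. An additive functor between exact categories is *exact* if it maps the pairs of the first exact structure to pairs of the second. Write $\mathcal E_{\max}$ for the class of all kernel–cokernel pairs and $\mathcal E_{\min}$ for the class of all split kernel–cokernel pairs. **Proposition.** Let $A$ be an operator algebra, and let $\mathcal E_{\mathrm{rel}}$ be the class of kernel–cokernel pairs $(\mu,\pi)$ in $\mathrm{OMOD}_A^\infty$ such that $(U\mu,U\pi)$ splits in $\mathrm{Op}^\infty$. Then $(\mathrm{OMOD}_A^\infty,\mathcal E_{\mathrm{rel}})$ is an exact category. Moreover, $\mathcal E_{\mathrm{rel}}$ is the relative exact structure induced by $\mathcal E_{\min}$ through the forgetful functor: $(\mathrm{OMOD}_A^\infty,\mathcal E_{\max})$, $(\mathrm{Op}^\infty,\mathcal E_{\max})$ and $(\mathrm{Op}^\infty,\mathcal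 E_{\min})$ are exact categories, the functor $U\colon(\mathrm{OMOD}_A^\infty,\mathcal E_{\max})\to(\mathrm{Op}^\infty,\mathcal E_{\max})$ is exact, and $$\mathcal E_{\mathrm{rel}}=\{(\mu,\pi)\in\mathcal E_{\max} : (U\mu,U\pi)\in\mathcal E_{\min}\}.$$ -/

import Mathlib

universe u w

namespace OpMod

section OperatorSpaces

/-- The data of a matrix norm: a real number for every square matrix over `E`. -/
class MatrixNorm (E : Type*) where
  /-- The norm on `M_n(E)`. -/
  mnorm : ∀ n : ℕ, Matrix (Fin n) (Fin n) E → ℝ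

/-- The product `α x β` of a scalar matrix, a matrix over `E` and a scalar matrix. -/
def scalarMulMul {E : Type*} [AddCommGroup E] [Module ℂ E] {n m : ℕ}
    (α : Matrix (Fin n) (Fin m) ℂ) (x : Matrix (Fin m) (Fin m) E)
    (β : Matrix (Fin m) (Fin n) ℂ) : Matrix (Fin n) (Fin n) E :=
  Matrix.of fun i j => ∑ k, ∑ l, (α i k * β l j) • x k l

/-- The diagonal direct sum `x ⊕ y ∈ M_{m+n}(E)` of `x ∈ M_m(E)` and `y ∈ M_n(E)`. -/
def directSum {E : Type*} [AddCommGroup E] {m n : ℕ}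
    (x : Matrix (Fin m) (Fin m) E) (y : Matrix (Fin n) (Fin n) E) :
    Matrix (Fin (m + n)) (Fin (m + n)) E :=
  Matrix.reindex finSumFinEquiv finSumFinEquiv (Matrix.fromBlocks x 0 0 y)

open scoped Matrix.Norms.L2Operator in
/-- A (complete, abstract) operator space: a complex Banach space `E` with a norm on every
`M_n(E)` such that `M_1(E) = E` isometrically and Ruan's two axioms hold. Scalar matrices carry
the operator norm of maps between finite-dimensional Hilbert spaces. -/
class OperatorSpace (E : Type*) [NormedAddCommGroup E] [NormedSpace ℂ E]
    extends MatrixNorm E, CompleteSpace E where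
  mnorm_add_le : ∀ (n : ℕ) (x y : Matrix (Fin n) (Fin n) E),
    mnorm n (x + y) ≤ mnorm n x + mnorm n y
  mnorm_smul : ∀ (n : ℕ) (c : ℂ) (x : Matrix (Fin n) (Fin n) E),
    mnorm n (c • x) = ‖c‖ * mnorm n x
  eq_zero_of_mnorm : ∀ (n : ℕ) (x : Matrix (Fin n) (Fin n) E), mnorm n x = 0 → x = 0
  mnorm_one : ∀ x : E, mnorm 1 (Matrix.of fun _ _ => x) = ‖x‖
  mnorm_directSum : ∀ (m n : ℕ) (x : Matrix (Fin m) (Fin m) E) (y : Matrix (Fin n) (Fin n) E),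
    mnorm (m + n) (directSum x y) = max (mnorm m x) (mnorm n y)
  mnorm_scalarMulMul_le : ∀ (n m : ℕ) (α : Matrix (Fin n) (Fin m) ℂ)
    (x : Matrix (Fin m) (Fin m) E) (β : Matrix (Fin m) (Fin n) ℂ),
    mnorm n (scalarMulMul α x β) ≤ ‖α‖ * mnorm m x * ‖β‖

/-- The norm of a rectangular matrix `x ∈ M_{m,n}(E)`, viewed as a corner of a square matrix
that is zero elsewhere. -/
def rectNorm {E : Type*} [AddCommGroup E] [MatrixNorm E] {m n : ℕ}
    (x : Matrix (Fin m) (Fin n) E) : ℝ :=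
  MatrixNorm.mnorm (m + n)
    (Matrix.reindex finSumFinEquiv finSumFinEquiv
      (Matrix.fromBlocks 0 x 0 0 : Matrix (Fin m ⊕ Fin n) (Fin m ⊕ Fin n) E))

open scoped TensorProduct in
/-- The matrix `x ⊙ y ∈ M_n(E ⊗ F)` with entries `∑ k, x i k ⊗ y k j`. -/
noncomputable def matTensor {E F : Type*} [AddCommGroup E] [Module ℂ E] [AddCommGroup F]
    [Module ℂ F] {n p : ℕ} (x : Matrix (Fin n) (Fin p) E) (y : Matrix (Fin p) (Fin n) F) :
    Matrix (Fin n) (Fin n) (E ⊗[ℂ] F) :=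
  Matrix.of fun i j => ∑ k, x i k ⊗ₜ[ℂ] y k j

open scoped TensorProduct in
/-- The Haagerup norm on `M_n(E ⊗ F)`: the infimum of `‖x‖ ‖y‖` over all `p` and all
`x ∈ M_{n,p}(E)`, `y ∈ M_{p,n}(F)` with `u = x ⊙ y`. The infimum is taken in `[0, ∞]`; it is
finite because such a factorisation always exists. -/
noncomputable def haagerupNorm {E F : Type*} [AddCommGroup E] [Module ℂ E] [MatrixNorm E]
    [AddCommGroup F] [Module ℂ F] [MatrixNorm F] {n : ℕ}
    (u : Matrix (Fin n) (Fin n) (E ⊗[ℂ] F)) : ENNReal :=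
  ⨅ (p : ℕ) (x : Matrix (Fin n) (Fin p) E) (y : Matrix (Fin p) (Fin n) F)
    (_ : u = matTensor x y), ENNReal.ofReal (rectNorm x * rectNorm y)

/-- A linear map is completely bounded if its amplifications to all `M_n` are uniformly
bounded. -/
def IsCompletelyBounded {E F : Type*} [AddCommGroup E] [Module ℂ E] [MatrixNorm E]
    [AddCommGroup F] [Module ℂ F] [MatrixNorm F] (f : E →ₗ[ℂ] F) : Prop :=
  ∃ C : ℝ, ∀ (n : ℕ) (x : Matrix (Fin n) (Fin n) E),
    MatrixNorm.mnorm n (x.map f) ≤ C * MatrixNorm.mnorm n x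

lemma mnorm_zero {E : Type*} [NormedAddCommGroup E] [NormedSpace ℂ E] [OperatorSpace E]
    (n : ℕ) : MatrixNorm.mnorm n (0 : Matrix (Fin n) (Fin n) E) = 0 := by
  simpa using OperatorSpace.mnorm_smul n 0 (0 : Matrix (Fin n) (Fin n) E)

lemma mnorm_nonneg {E : Type*} [NormedAddCommGroup E] [NormedSpace ℂ E] [OperatorSpace E]
    (n : ℕ) (x : Matrix (Fin n) (Fin n) E) : 0 ≤ MatrixNorm.mnorm n x := by
  have h1 := OperatorSpace.mnorm_add_le n x ((-1 : ℂ) • x)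
  have h2 := OperatorSpace.mnorm_smul n (-1) x
  have h3 : x + (-1 : ℂ) • x = 0 := by simp
  rw [h3, mnorm_zero, h2, norm_neg, norm_one] at h1
  linarith

/-- `CB(E, F)`, the space of completely bounded linear maps. -/
def CB (E F : Type*) [NormedAddCommGroup E] [NormedSpace ℂ E] [OperatorSpace E]
    [NormedAddCommGroup F] [NormedSpace ℂ F] [OperatorSpace F] : Submodule ℂ (E →ₗ[ℂ] F) where
  carrier := {f | IsCompletelyBounded f}
  zero_mem' := ⟨0, fun n x => by
    have h : x.map (0 : E →ₗ[ℂ] F) = 0 := by ext; simp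
    rw [h, mnorm_zero, zero_mul]⟩
  add_mem' := by
    rintro f g ⟨C, hC⟩ ⟨D, hD⟩
    refine ⟨C + D, fun n x => ?_⟩
    have h : x.map (f + g : E →ₗ[ℂ] F) = x.map f + x.map g := by ext; simp
    rw [h, add_mul]
    exact (OperatorSpace.mnorm_add_le n _ _).trans (add_le_add (hC n x) (hD n x))
  smul_mem' := by
    rintro c f ⟨C, hC⟩
    refine ⟨‖c‖ * C, fun n x => ?_⟩
    have h : x.map (c • f : E →ₗ[ℂ] F) = c • x.map f := by ext; simp
    rw [h, OperatorSpace.mnorm_smul, mul_assoc]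
    exact mul_le_mul_of_nonneg_left (hC n x) (norm_nonneg c)

lemma id_mem_CB (E : Type*) [NormedAddCommGroup E] [NormedSpace ℂ E] [OperatorSpace E] :
    LinearMap.id ∈ CB E E :=
  ⟨1, fun n x => by
    have h : x.map (LinearMap.id : E →ₗ[ℂ] E) = x := by ext; simp
    rw [h, one_mul]⟩

lemma comp_mem_CB {E F G : Type*} [NormedAddCommGroup E] [NormedSpace ℂ E] [OperatorSpace E]
    [NormedAddCommGroup F] [NormedSpace ℂ F] [OperatorSpace F]
    [NormedAddCommGroup G] [NormedSpace ℂ G] [OperatorSpace G]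
    {f : E →ₗ[ℂ] F} {g : F →ₗ[ℂ] G} (hf : f ∈ CB E F) (hg : g ∈ CB F G) :
    g ∘ₗ f ∈ CB E G := by
  obtain ⟨C, hC⟩ := hf
  obtain ⟨D, hD⟩ := hg
  refine ⟨|D| * C, fun n x => ?_⟩
  have h : x.map (g ∘ₗ f) = (x.map f).map g := by ext; simp
  rw [h, mul_assoc]
  calc MatrixNorm.mnorm n ((x.map f).map g) ≤ D * MatrixNorm.mnorm n (x.map f) := hD n _
    _ ≤ |D| * MatrixNorm.mnorm n (x.map f) :=
        mul_le_mul_of_nonneg_right (le_abs_self D) (mnorm_nonneg n _)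
    _ ≤ |D| * (C * MatrixNorm.mnorm n x) :=
        mul_le_mul_of_nonneg_left (hC n x) (abs_nonneg D)

end OperatorSpaces

section OperatorAlgebras

/-- An operator algebra on the Hilbert space `H`: a norm-closed subalgebra of `B(H)` (not
necessarily unital) that contains a contractive (two-sided) approximate identity. -/
structure OperatorAlgebra (H : Type*) [NormedAddCommGroup H] [InnerProductSpace ℂ H]
    [CompleteSpace H] where
  /-- The underlying subalgebra of `B(H)`. -/
  alg : NonUnitalSubalgebra ℂ (H →L[ℂ] H)
  isClosed : IsClosed (alg : Set (H →L[ℂ] H))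
  exists_cai : ∃ l : Filter alg, l.IsApproximateUnit ∧ ∀ᶠ e in l, ‖e‖ ≤ 1

variable {H : Type*} [NormedAddCommGroup H] [InnerProductSpace ℂ H] [CompleteSpace H]

/-- The operator on the Hilbert space `H^n` given by a matrix of operators on `H`. -/
noncomputable def matrixToCLM {n : ℕ} (a : Matrix (Fin n) (Fin n) (H →L[ℂ] H)) :
    PiLp 2 (fun _ : Fin n => H) →L[ℂ] PiLp 2 (fun _ : Fin n => H) :=
  (PiLp.continuousLinearEquiv 2 ℂ (fun _ : Fin n => H)).symm.toContinuousLinearMap ∘L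
    ContinuousLinearMap.pi fun i => ∑ j, a i j ∘L PiLp.proj 2 (fun _ : Fin n => H) j

/-- The canonical matrix norm of an operator algebra: `M_n(A) ⊆ M_n(B(H)) = B(H^n)`. -/
noncomputable instance (A : OperatorAlgebra H) : MatrixNorm A.alg where
  mnorm _ a := ‖matrixToCLM (a.map Subtype.val)‖

open scoped TensorProduct in
/-- A non-degenerate right operator `A`-module structure on the operator space `E`: an
associative bilinear right action whose induced map `E ⊗ A → E` is completely contractive for the
Haagerup norm (equivalently, as `E` is complete, its continuous extension to the completed
Haagerup tensor product is completely contractive), such that the elements `x · a` span a dense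
subspace. -/
class OperatorModule (A : OperatorAlgebra H) (E : Type*) [NormedAddCommGroup E]
    [NormedSpace ℂ E] [OperatorSpace E] where
  /-- The right action `act x a = x · a`. -/
  act : E →ₗ[ℂ] A.alg →ₗ[ℂ] E
  act_mul : ∀ (x : E) (a b : A.alg), act x (a * b) = act (act x a) b
  completelyContractive : ∀ (n : ℕ) (u : Matrix (Fin n) (Fin n) (E ⊗[ℂ] A.alg)),
    ENNReal.ofReal (MatrixNorm.mnorm n (u.map (TensorProduct.lift act))) ≤ haagerupNorm u
  nondegenerate : Dense (Submodule.span ℂ {y : E | ∃ x a, y = act x a} : Set E)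

/-- `CB_A(E, F)`, the completely bounded `A`-module maps. -/
def CBmod (A : OperatorAlgebra H) (E F : Type*) [NormedAddCommGroup E] [NormedSpace ℂ E]
    [OperatorSpace E] [OperatorModule A E] [NormedAddCommGroup F] [NormedSpace ℂ F]
    [OperatorSpace F] [OperatorModule A F] : Submodule ℂ (E →ₗ[ℂ] F) where
  carrier := {f | f ∈ CB E F ∧ ∀ (x : E) (a : A.alg),
    f (OperatorModule.act x a) = OperatorModule.act (f x) a}
  zero_mem' := ⟨(CB E F).zero_mem, fun x a => by simp⟩
  add_mem' hf hg := ⟨(CB E F).add_mem hf.1 hg.1, fun x a => by simp [hf.2, hg.2]⟩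
  smul_mem' c _ hf := ⟨(CB E F).smul_mem c hf.1, fun x a => by simp [hf.2]⟩

end OperatorAlgebras

section Categories

open CategoryTheory

/-- Operator spaces, as objects of the category `Op`. -/
structure Op : Type (u + 1) where
  carrier : Type u
  [normedAddCommGroup : NormedAddCommGroup carrier]
  [normedSpace : NormedSpace ℂ carrier]
  [operatorSpace : OperatorSpace carrier]

attribute [instance] Op.normedAddCommGroup Op.normedSpace Op.operatorSpace

/-- The category of operator spaces and completely bounded linear maps. -/
instance : Category Op.{u} where
  Hom E F := CB E.carrier F.carrier
  id E := ⟨LinearMap.id, id_mem_CB E.carrier⟩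
  comp f g := ⟨g.1 ∘ₗ f.1, comp_mem_CB f.2 g.2⟩

instance : Preadditive Op.{u} where
  homGroup E F := inferInstanceAs (AddCommGroup (CB E.carrier F.carrier))
  add_comp _ _ _ f f' g := Subtype.ext (LinearMap.comp_add f.1 f'.1 g.1)
  comp_add _ _ _ f g g' := Subtype.ext (LinearMap.add_comp f.1 g'.1 g.1)

variable {H : Type*} [NormedAddCommGroup H] [InnerProductSpace ℂ H] [CompleteSpace H]

/-- Non-degenerate right operator `A`-modules, as objects of the category `OMod A`. -/
structure OMod (A : OperatorAlgebra H) where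
  carrier : Type u
  [normedAddCommGroup : NormedAddCommGroup carrier]
  [normedSpace : NormedSpace ℂ carrier]
  [operatorSpace : OperatorSpace carrier]
  [operatorModule : OperatorModule A carrier]

attribute [instance] OMod.normedAddCommGroup OMod.normedSpace OMod.operatorSpace
  OMod.operatorModule

/-- The category of non-degenerate right operator `A`-modules and completely bounded `A`-module
maps. -/
instance (A : OperatorAlgebra H) : Category (OMod.{u} A) where
  Hom E F := CBmod A E.carrier F.carrier
  id E := ⟨LinearMap.id, id_mem_CB E.carrier, fun _ _ => rfl⟩
  comp f g := ⟨g.1 ∘ₗ f.1, comp_mem_CB f.2.1 g.2.1, fun x a =>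
    (congrArg g.1 (f.2.2 x a)).trans (g.2.2 (f.1 x) a)⟩

instance (A : OperatorAlgebra H) : Preadditive (OMod.{u} A) where
  homGroup E F := inferInstanceAs (AddCommGroup (CBmod A E.carrier F.carrier))
  add_comp _ _ _ f f' g := Subtype.ext (LinearMap.comp_add f.1 f'.1 g.1)
  comp_add _ _ _ f g g' := Subtype.ext (LinearMap.add_comp f.1 g'.1 g.1)

/-- The functor that forgets the module action. -/
def forget (A : OperatorAlgebra H) : OMod.{u} A ⥤ Op.{u} where
  obj E := ⟨E.carrier⟩
  map f := ⟨f.1, f.2.1⟩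

instance (A : OperatorAlgebra H) : (forget.{u} A).Additive where
  map_add := rfl

end Categories

section ExactCategories

open CategoryTheory CategoryTheory.Limits

variable {C : Type*} [Category* C] [Preadditive C]

/-- A composable pair `(μ, π)` with `μ ≫ π = 0` is a kernel-cokernel pair if `μ` is a kernel of
`π` and `π` is a cokernel of `μ`. -/
def IsKernelCokernelPair (S : ShortComplex C) : Prop :=
  Nonempty (IsLimit (KernelFork.ofι S.f S.zero)) ∧
    Nonempty (IsColimit (CokernelCofork.ofπ S.g S.zero))

/-- `μ` is an admissible monomorphism for the class `E`: `(μ, π) ∈ E` for some `π`. -/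
def AdmissibleMono (E : ObjectProperty (ShortComplex C)) {X Y : C} (μ : X ⟶ Y) : Prop :=
  ∃ (Z : C) (π : Y ⟶ Z) (w : μ ≫ π = 0), E (ShortComplex.mk μ π w)

/-- `π` is an admissible epimorphism for the class `E`: `(μ, π) ∈ E` for some `μ`. -/
def AdmissibleEpi (E : ObjectProperty (ShortComplex C)) {Y Z : C} (π : Y ⟶ Z) : Prop :=
  ∃ (X : C) (μ : X ⟶ Y) (w : μ ≫ π = 0), E (ShortComplex.mk μ π w)

/-- An exact structure (in the sense of Quillen): a class of kernel-cokernel pairs, closed under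
isomorphisms, satisfying the axioms E0, E1, E2 and their duals. -/
structure IsExactStructure (E : ObjectProperty (ShortComplex C)) : Prop where
  isKernelCokernelPair : ∀ S : ShortComplex C, E S → IsKernelCokernelPair S
  of_iso : ∀ S T : ShortComplex C, Nonempty (S ≅ T) → E S → E T
  id_mono : ∀ X : C, AdmissibleMono E (𝟙 X)
  id_epi : ∀ X : C, AdmissibleEpi E (𝟙 X)
  comp_mono : ∀ {X Y Z : C} (f : X ⟶ Y) (g : Y ⟶ Z),
    AdmissibleMono E f → AdmissibleMono E g → AdmissibleMono E (f ≫ g)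
  comp_epi : ∀ {X Y Z : C} (f : X ⟶ Y) (g : Y ⟶ Z),
    AdmissibleEpi E f → AdmissibleEpi E g → AdmissibleEpi E (f ≫ g)
  pushout : ∀ {X Y Z : C} (f : X ⟶ Y) (g : X ⟶ Z), AdmissibleMono E f →
    HasPushout f g ∧ ∀ {P : C} (inl : Y ⟶ P) (inr : Z ⟶ P),
      IsPushout f g inl inr → AdmissibleMono E inr
  pullback : ∀ {X Y Z : C} (f : X ⟶ Z) (g : Y ⟶ Z), AdmissibleEpi E f →
    HasPullback f g ∧ ∀ {P : C} (fst : P ⟶ X) (snd : P ⟶ Y),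
      IsPullback fst snd f g → AdmissibleEpi E snd

/-- `(C, E)` is an exact category: `C` is additive (it has a zero object and binary products, on
top of its preadditive structure) and `E` is an exact structure on `C`. -/
structure IsExactCategory (E : ObjectProperty (ShortComplex C)) : Prop where
  hasZeroObject : HasZeroObject C
  hasBinaryProducts : HasBinaryProducts C
  isExactStructure : IsExactStructure E

variable (C) in
/-- The class of all kernel-cokernel pairs. -/
def Emax : ObjectProperty (ShortComplex C) := fun S => IsKernelCokernelPair S

variable (C) in
/-- The class of all split kernel-cokernel pairs. -/
def Emin : ObjectProperty (ShortComplex C) := fun S =>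
  IsKernelCokernelPair S ∧ Nonempty S.Splitting

variable {D : Type*} [Category* D] [Preadditive D]

/-- The additive functor `F : (C, E₁) ⥤ (D, E₂)` between exact categories is exact. -/
structure IsExactFunctor (F : C ⥤ D) [F.Additive] (E₁ : ObjectProperty (ShortComplex C))
    (E₂ : ObjectProperty (ShortComplex D)) : Prop where
  source : IsExactCategory E₁
  target : IsExactCategory E₂
  map_mem : ∀ S : ShortComplex C, E₁ S → E₂ (S.map F)

/-- The class of all `(μ, π) ∈ E₁` with `(F μ, F π) ∈ E₂'`. -/
def relativeClass (F : C ⥤ D) [F.Additive] (E₁ : ObjectProperty (ShortComplex C))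
    (E₂' : ObjectProperty (ShortComplex D)) : ObjectProperty (ShortComplex C) :=
  fun S => E₁ S ∧ E₂' (S.map F)

end ExactCategories

section Relative

open CategoryTheory

variable {H : Type*} [NormedAddCommGroup H] [InnerProductSpace ℂ H] [CompleteSpace H]

/-- The class of kernel-cokernel pairs of operator `A`-modules that split as pairs of completely
bounded maps of operator spaces. -/
def Erel (A : OperatorAlgebra H) : ObjectProperty (ShortComplex (OMod.{u} A)) :=
  fun S => IsKernelCokernelPair S ∧ Nonempty (S.map (forget A)).Splitting

end Relative

end OpMod

/-!
The forgetful functor `U` reflects isomorphisms and preserves kernels and cokernels, because a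
closed invariant subspace of an operator module and the quotient by it are again operator modules.
The only delicate point there is non-degeneracy: as `A` has a contractive approximate identity, `E`
is non-degenerate if and only if `x · e → x` along each such approximate identity, and this
condition visibly passes to subspaces and quotients. Consequently a pair of module maps is a
kernel-cokernel pair as soon as its image under `U` is one, and the inverse image under `U` of any
exact structure on operator spaces is an exact structure on operator modules. The class `Emax` of
modules is the inverse image of `Emax`, and `Erel` is the inverse image of `Emin`.

For split pairs the axioms hold in every additive category. For `Emax` of operator spaces, the
admissible monomorphisms are the maps that are bounded below uniformly in the matrix size, and the
admissible epimorphisms are those for which preimages can be chosen with uniform bounds; both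
conditions survive cobase and base change by an explicit estimate.
-/

namespace OpMod

open CategoryTheory CategoryTheory.Limits MatrixNorm OperatorSpace
open scoped Matrix.Norms.L2Operator NNReal

/-! ### Matrices over an operator space -/

section Matrices

section ScalarMatrices

variable {ι κ : Type*} [Fintype ι] [Fintype κ] [DecidableEq κ]

lemma norm_diagonal_le_one {a : κ → ℂ} (ha : ∀ i, ‖a i‖ ≤ 1) : ‖Matrix.diagonal a‖ ≤ 1 :=
  (Matrix.l2_opNorm_diagonal a).trans_le ((pi_norm_le_iff_of_nonneg zero_le_one).2 ha)

lemma norm_one_submatrix_left_le_one {σ : ι → κ} (hσ : Function.Injective σ) :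
    ‖(1 : Matrix κ κ ℂ).submatrix σ id‖ ≤ 1 := by
  classical
  set S := (1 : Matrix κ κ ℂ).submatrix σ id
  have mul_conjTranspose : S * S.conjTranspose = 1 := by
    rw [Matrix.conjTranspose_submatrix, Matrix.conjTranspose_one,
      ← Matrix.submatrix_mul _ _ σ id σ Function.bijective_id, one_mul, Matrix.submatrix_one σ hσ]
  have norm_mul_self : ‖S‖ * ‖S‖ ≤ 1 := by
    rw [← Matrix.l2_opNorm_conjTranspose S, ← Matrix.l2_opNorm_conjTranspose_mul_self,
      Matrix.conjTranspose_conjTranspose, mul_conjTranspose, ← Matrix.diagonal_one]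
    exact norm_diagonal_le_one fun _ => norm_one.le
  exact abs_le_one_iff_mul_self_le_one.2 norm_mul_self |>.trans' (le_abs_self _)

lemma norm_one_submatrix_right_le_one [DecidableEq ι] {σ : ι → κ} (hσ : Function.Injective σ) :
    ‖(1 : Matrix κ κ ℂ).submatrix id σ‖ ≤ 1 := by
  rw [← Matrix.l2_opNorm_conjTranspose, Matrix.conjTranspose_submatrix, Matrix.conjTranspose_one]
  exact norm_one_submatrix_left_le_one hσ

end ScalarMatrices

section Entries

variable {E F : Type*} [AddCommGroup E]

/-- The embedding of a rectangular matrix as the upper right corner of a square matrix, so that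
`rectNorm x` is the norm of `corner x`. -/
def corner {m n : ℕ} (x : Matrix (Fin m) (Fin n) E) : Matrix (Fin (m + n)) (Fin (m + n)) E :=
  Matrix.reindex finSumFinEquiv finSumFinEquiv (Matrix.fromBlocks 0 x 0 0)

lemma rectNorm_eq_mnorm_corner [MatrixNorm E] {m n : ℕ} (x : Matrix (Fin m) (Fin n) E) :
    rectNorm x = mnorm (m + n) (corner x) := rfl

lemma directSum_submatrix_castAdd {m n : ℕ} (x : Matrix (Fin m) (Fin m) E)
    (y : Matrix (Fin n) (Fin n) E) :
    (directSum x y).submatrix (Fin.castAdd n) (Fin.castAdd n) = x := by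
  ext i j; simp [directSum]

lemma directSum_submatrix_natAdd {m n : ℕ} (x : Matrix (Fin m) (Fin m) E)
    (y : Matrix (Fin n) (Fin n) E) :
    (directSum x y).submatrix (Fin.natAdd m) (Fin.natAdd m) = y := by
  ext i j; simp [directSum]

lemma corner_eq_directSum_submatrix {n : ℕ} (x : Matrix (Fin n) (Fin n) E) :
    corner x = (directSum x 0).submatrix id
      (finSumFinEquiv.symm.trans ((Equiv.sumComm _ _).trans finSumFinEquiv)) := by
  ext i j
  obtain ⟨i, rfl⟩ := finSumFinEquiv.surjective i
  obtain ⟨j, rfl⟩ := finSumFinEquiv.surjective j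
  rcases i with i | i <;> rcases j with j | j <;>
    simp [corner, directSum, -finSumFinEquiv_apply_right]

section Map

variable [AddCommGroup F]

lemma map_directSum (f : E →+ F) {m n : ℕ} (x : Matrix (Fin m) (Fin m) E)
    (y : Matrix (Fin n) (Fin n) E) : (directSum x y).map f = directSum (x.map f) (y.map f) := by
  simp only [directSum, Matrix.reindex_apply, ← Matrix.submatrix_map, Matrix.fromBlocks_map,
    Matrix.map_zero f (map_zero f)]

lemma map_corner (f : E →+ F) {m n : ℕ} (x : Matrix (Fin m) (Fin n) E) :
    (corner x).map f = corner (x.map f) := by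
  simp only [corner, Matrix.reindex_apply, ← Matrix.submatrix_map, Matrix.fromBlocks_map,
    Matrix.map_zero f (map_zero f)]

end Map

variable [Module ℂ E]

lemma map_scalarMulMul [AddCommGroup F] [Module ℂ F] (f : E →ₗ[ℂ] F) {n m : ℕ}
    (α : Matrix (Fin n) (Fin m) ℂ) (x : Matrix (Fin m) (Fin m) E) (β : Matrix (Fin m) (Fin n) ℂ) :
    (scalarMulMul α x β).map f = scalarMulMul α (x.map f) β := by
  ext i j; simp [scalarMulMul]

lemma scalarMulMul_one_submatrix {n m : ℕ} (x : Matrix (Fin m) (Fin m) E) (σ τ : Fin n → Fin m) :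
    scalarMulMul ((1 : Matrix (Fin m) (Fin m) ℂ).submatrix σ id) x
      ((1 : Matrix (Fin m) (Fin m) ℂ).submatrix id τ) = x.submatrix σ τ := by
  ext i j
  simp [scalarMulMul, Matrix.one_apply, ite_smul]

lemma scalarMulMul_diagonal {n : ℕ} (a b : Fin n → ℂ) (x : Matrix (Fin n) (Fin n) E) :
    scalarMulMul (Matrix.diagonal a) x (Matrix.diagonal b) =
      Matrix.of fun i j => (a i * b j) • x i j := by
  ext i j
  simp [scalarMulMul, Matrix.diagonal_apply, mul_smul, ite_smul]

end Entries

section Norms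

variable {E : Type*} [NormedAddCommGroup E] [NormedSpace ℂ E] [OperatorSpace E]

lemma mnorm_scalarMulMul_le_of_le_one {n m : ℕ} {α : Matrix (Fin n) (Fin m) ℂ}
    {β : Matrix (Fin m) (Fin n) ℂ} (hα : ‖α‖ ≤ 1) (hβ : ‖β‖ ≤ 1)
    (x : Matrix (Fin m) (Fin m) E) : mnorm n (scalarMulMul α x β) ≤ mnorm m x := by
  have := mnorm_nonneg m x
  calc mnorm n (scalarMulMul α x β) ≤ ‖α‖ * mnorm m x * ‖β‖ := mnorm_scalarMulMul_le n m α x β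
    _ ≤ 1 * mnorm m x * 1 := by gcongr
    _ = mnorm m x := by ring

lemma mnorm_submatrix_le {n m : ℕ} {σ τ : Fin n → Fin m} (hσ : Function.Injective σ)
    (hτ : Function.Injective τ) (x : Matrix (Fin m) (Fin m) E) :
    mnorm n (x.submatrix σ τ) ≤ mnorm m x := by
  rw [← scalarMulMul_one_submatrix]
  exact mnorm_scalarMulMul_le_of_le_one (norm_one_submatrix_left_le_one hσ)
    (norm_one_submatrix_right_le_one hτ) x

lemma norm_apply_le_mnorm {n : ℕ} (x : Matrix (Fin n) (Fin n) E) (i j : Fin n) :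
    ‖x i j‖ ≤ mnorm n x := by
  rw [← mnorm_one]
  exact mnorm_submatrix_le (n := 1) (σ := fun _ => i) (τ := fun _ => j)
    (Function.injective_of_subsingleton _) (Function.injective_of_subsingleton _) x

lemma rectNorm_nonneg {m n : ℕ} (x : Matrix (Fin m) (Fin n) E) : 0 ≤ rectNorm x :=
  mnorm_nonneg _ _

lemma rectNorm_le_mnorm {n : ℕ} (x : Matrix (Fin n) (Fin n) E) : rectNorm x ≤ mnorm n x := by
  rw [rectNorm_eq_mnorm_corner, corner_eq_directSum_submatrix]
  refine (mnorm_submatrix_le Function.injective_id (Equiv.injective _) _).trans_eq ?_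
  rw [mnorm_directSum, mnorm_zero, max_eq_left (mnorm_nonneg n x)]

lemma rectNorm_submatrix_castAdd_natAdd_le {m n : ℕ} (x : Matrix (Fin (m + n)) (Fin (m + n)) E) :
    rectNorm (x.submatrix (Fin.castAdd n) (Fin.natAdd m)) ≤ mnorm (m + n) x := by
  let a : Fin (m + n) → ℂ := Fin.addCases (fun _ => 1) (fun _ => 0)
  let b : Fin (m + n) → ℂ := Fin.addCases (fun _ => 0) (fun _ => 1)
  have corner_eq : corner (x.submatrix (Fin.castAdd n) (Fin.natAdd m)) =
      scalarMulMul (Matrix.diagonal a) x (Matrix.diagonal b) := by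
    rw [scalarMulMul_diagonal]
    ext i j
    cases i using Fin.addCases <;> cases j using Fin.addCases <;> simp [corner, a, b]
  rw [rectNorm_eq_mnorm_corner, corner_eq]
  refine mnorm_scalarMulMul_le_of_le_one (norm_diagonal_le_one fun i => ?_)
    (norm_diagonal_le_one fun i => ?_) x <;>
  cases i using Fin.addCases <;> simp [a, b]

end Norms

end Matrices

/-! ### Complete bounds -/

section CompleteBounds

variable {E F G H : Type*}

section Defs

variable [AddCommGroup E] [Module ℂ E] [MatrixNorm E] [AddCommGroup F] [Module ℂ F] [MatrixNorm F]

/-- A linear map is completely bounded below if its amplifications to all `M_n` are bounded below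
by a common positive constant; these are the admissible monomorphisms of operator spaces. -/
def IsCompletelyBoundedBelow (f : E →ₗ[ℂ] F) : Prop :=
  ∃ C : ℝ≥0, ∀ (n : ℕ) (x : Matrix (Fin n) (Fin n) E), mnorm n x ≤ C * mnorm n (x.map f)

/-- A linear map is completely open if every matrix over its codomain has a preimage of norm
controlled uniformly in the size of the matrix; these are the admissible epimorphisms of operator
spaces. -/
def IsCompletelyOpen (f : E →ₗ[ℂ] F) : Prop :=
  ∃ C : ℝ≥0, ∀ (n : ℕ) (y : Matrix (Fin n) (Fin n) F),
    ∃ x : Matrix (Fin n) (Fin n) E, x.map f = y ∧ mnorm n x ≤ C * mnorm n y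

end Defs

section Norms

variable [NormedAddCommGroup E] [NormedSpace ℂ E] [OperatorSpace E]
  [NormedAddCommGroup F] [NormedSpace ℂ F] [OperatorSpace F] {f : E →ₗ[ℂ] F}

lemma IsCompletelyBounded.exists_lipschitzWith (hf : IsCompletelyBounded f) :
    ∃ C, LipschitzWith C f := by
  obtain ⟨C, hC⟩ := hf
  refine ⟨C.toNNReal, AddMonoidHomClass.lipschitz_of_bound f C fun x => ?_⟩
  rw [← mnorm_one, ← mnorm_one]
  exact hC 1 (Matrix.of fun _ _ => x)

lemma IsCompletelyBounded.isClosed_ker (hf : IsCompletelyBounded f) :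
    IsClosed (LinearMap.ker f : Set E) :=
  have ⟨_, hC⟩ := hf.exists_lipschitzWith
  isClosed_singleton.preimage hC.continuous

lemma IsCompletelyBoundedBelow.exists_antilipschitzWith (hf : IsCompletelyBoundedBelow f) :
    ∃ C, AntilipschitzWith C f := by
  obtain ⟨C, hC⟩ := hf
  refine ⟨C, AddMonoidHomClass.antilipschitz_of_bound f fun x => ?_⟩
  rw [← mnorm_one, ← mnorm_one]
  exact hC 1 (Matrix.of fun _ _ => x)

lemma IsCompletelyBoundedBelow.injective (hf : IsCompletelyBoundedBelow f) :
    Function.Injective f :=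
  have ⟨_, hC⟩ := hf.exists_antilipschitzWith
  hC.injective

lemma IsCompletelyBoundedBelow.isClosed_range (hf : IsCompletelyBoundedBelow f)
    (hf' : IsCompletelyBounded f) : IsClosed (LinearMap.range f : Set F) := by
  obtain ⟨C, hC⟩ := hf.exists_antilipschitzWith
  obtain ⟨D, hD⟩ := hf'.exists_lipschitzWith
  exact hC.isClosed_range hD.uniformContinuous

end Norms

section Comp

lemma IsCompletelyBounded.exists_nnreal [NormedAddCommGroup E] [NormedSpace ℂ E]
    [OperatorSpace E] [AddCommGroup F] [Module ℂ F] [MatrixNorm F] {f : E →ₗ[ℂ] F}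
    (hf : IsCompletelyBounded f) : ∃ C : ℝ≥0, ∀ (n : ℕ) (x : Matrix (Fin n) (Fin n) E),
      mnorm n (x.map f) ≤ C * mnorm n x := by
  obtain ⟨C, hC⟩ := hf
  exact ⟨C.toNNReal, fun n x => (hC n x).trans <|
    mul_le_mul_of_nonneg_right C.le_coe_toNNReal (mnorm_nonneg n x)⟩

variable [AddCommGroup E] [Module ℂ E] [MatrixNorm E]

namespace IsCompletelyBoundedBelow

variable [AddCommGroup G] [Module ℂ G] [MatrixNorm G]

lemma id : IsCompletelyBoundedBelow (LinearMap.id : E →ₗ[ℂ] E) :=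
  ⟨1, fun _ _ => (one_mul _).ge⟩

lemma comp [AddCommGroup F] [Module ℂ F] [MatrixNorm F] {g : F →ₗ[ℂ] G} {f : E →ₗ[ℂ] F}
    (hg : IsCompletelyBoundedBelow g) (hf : IsCompletelyBoundedBelow f) :
    IsCompletelyBoundedBelow (g ∘ₗ f) := by
  obtain ⟨C, hC⟩ := hf
  obtain ⟨D, hD⟩ := hg
  refine ⟨C * D, fun n x => (hC n x).trans ?_⟩
  rw [NNReal.coe_mul, mul_assoc]
  exact mul_le_mul_of_nonneg_left (hD n _) C.2

lemma of_comp [NormedAddCommGroup F] [NormedSpace ℂ F] [OperatorSpace F] {g : F →ₗ[ℂ] G}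
    {f : E →ₗ[ℂ] F} (h : IsCompletelyBoundedBelow (g ∘ₗ f)) (hg : IsCompletelyBounded g) :
    IsCompletelyBoundedBelow f := by
  obtain ⟨C, hC⟩ := h
  obtain ⟨D, hD⟩ := hg.exists_nnreal
  refine ⟨C * D, fun n x => (hC n x).trans ?_⟩
  rw [NNReal.coe_mul, mul_assoc]
  exact mul_le_mul_of_nonneg_left (hD n _) C.2

lemma isCompletelyBounded_of_comp [AddCommGroup F] [Module ℂ F] [MatrixNorm F]
    {g : F →ₗ[ℂ] G} {f : E →ₗ[ℂ] F} (hg : IsCompletelyBoundedBelow g)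
    (h : IsCompletelyBounded (g ∘ₗ f)) : IsCompletelyBounded f := by
  obtain ⟨C, hC⟩ := hg
  obtain ⟨D, hD⟩ := h
  refine ⟨C * D, fun n x => (hC n _).trans ?_⟩
  rw [mul_assoc]
  exact mul_le_mul_of_nonneg_left (hD n x) C.2

lemma exists_lift [NormedAddCommGroup F] [NormedSpace ℂ F] [OperatorSpace F]
    [NormedAddCommGroup H] [NormedSpace ℂ H] [OperatorSpace H] {g : F →ₗ[ℂ] H}
    {k : E →ₗ[ℂ] H} (hg : IsCompletelyBoundedBelow g) (hk : IsCompletelyBounded k)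
    (h : LinearMap.range k ≤ LinearMap.range g) :
    ∃ l : E →ₗ[ℂ] F, IsCompletelyBounded l ∧ g ∘ₗ l = k := by
  obtain ⟨r, hr⟩ := g.exists_leftInverse_of_injective (LinearMap.ker_eq_bot.2 hg.injective)
  have hl : g ∘ₗ (r ∘ₗ k) = k := by
    ext x
    obtain ⟨y, hy⟩ := h (LinearMap.mem_range_self k x)
    simp only [LinearMap.comp_apply, ← hy]
    exact congrArg g (LinearMap.congr_fun hr y)
  exact ⟨r ∘ₗ k, hg.isCompletelyBounded_of_comp (hl.symm ▸ hk), hl⟩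

end IsCompletelyBoundedBelow

namespace IsCompletelyOpen

variable [AddCommGroup F] [Module ℂ F] [MatrixNorm F]

lemma id : IsCompletelyOpen (LinearMap.id : E →ₗ[ℂ] E) :=
  ⟨1, fun _ x => ⟨x, rfl, (one_mul _).ge⟩⟩

lemma surjective {f : E →ₗ[ℂ] F} (hf : IsCompletelyOpen f) : Function.Surjective f := by
  obtain ⟨C, hC⟩ := hf
  intro y
  obtain ⟨x, hx, -⟩ := hC 1 (Matrix.of fun _ _ => y)
  exact ⟨x 0 0, congrFun (congrFun hx 0) 0⟩

variable [AddCommGroup G] [Module ℂ G] [MatrixNorm G]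

lemma comp {g : F →ₗ[ℂ] G} {f : E →ₗ[ℂ] F} (hg : IsCompletelyOpen g)
    (hf : IsCompletelyOpen f) : IsCompletelyOpen (g ∘ₗ f) := by
  obtain ⟨C, hC⟩ := hf
  obtain ⟨D, hD⟩ := hg
  refine ⟨C * D, fun n z => ?_⟩
  obtain ⟨y, rfl, hy⟩ := hD n z
  obtain ⟨x, rfl, hx⟩ := hC n y
  refine ⟨x, rfl, hx.trans ?_⟩
  rw [NNReal.coe_mul, mul_assoc]
  exact mul_le_mul_of_nonneg_left hy C.2

end IsCompletelyOpen

end Comp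

namespace IsCompletelyOpen

variable [NormedAddCommGroup E] [NormedSpace ℂ E] [OperatorSpace E] [AddCommGroup F] [Module ℂ F]
  [MatrixNorm F] [AddCommGroup G] [Module ℂ G] [MatrixNorm G]

lemma of_comp {g : F →ₗ[ℂ] G} {f : E →ₗ[ℂ] F} (h : IsCompletelyOpen (g ∘ₗ f))
    (hf : IsCompletelyBounded f) : IsCompletelyOpen g := by
  obtain ⟨C, hC⟩ := h
  obtain ⟨D, hD⟩ := hf.exists_nnreal
  refine ⟨D * C, fun n z => ?_⟩
  obtain ⟨x, rfl, hx⟩ := hC n z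
  refine ⟨x.map f, rfl, (hD n x).trans ?_⟩
  rw [NNReal.coe_mul, mul_assoc]
  exact mul_le_mul_of_nonneg_left hx D.2

lemma isCompletelyBounded_of_comp {g : F →ₗ[ℂ] G} {f : E →ₗ[ℂ] F} (hf : IsCompletelyOpen f)
    (h : IsCompletelyBounded (g ∘ₗ f)) : IsCompletelyBounded g := by
  obtain ⟨C, hC⟩ := hf
  obtain ⟨D, hD⟩ := h.exists_nnreal
  refine ⟨D * C, fun n y => ?_⟩
  obtain ⟨x, rfl, hx⟩ := hC n y
  refine (hD n x).trans ?_
  rw [mul_assoc]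
  exact mul_le_mul_of_nonneg_left hx D.2

lemma exists_desc {f : E →ₗ[ℂ] F} {k : E →ₗ[ℂ] G} (hf : IsCompletelyOpen f)
    (hk : IsCompletelyBounded k) (h : LinearMap.ker f ≤ LinearMap.ker k) :
    ∃ l : F →ₗ[ℂ] G, IsCompletelyBounded l ∧ l ∘ₗ f = k := by
  obtain ⟨s, hs⟩ := f.exists_rightInverse_of_surjective (LinearMap.range_eq_top.2 hf.surjective)
  have hl : (k ∘ₗ s) ∘ₗ f = k := by
    ext x
    have : s (f x) - x ∈ LinearMap.ker f := by
      rw [LinearMap.mem_ker, map_sub, sub_eq_zero]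
      exact LinearMap.congr_fun hs (f x)
    exact sub_eq_zero.1 ((map_sub k _ _).symm.trans (h this))
  exact ⟨k ∘ₗ s, hf.isCompletelyBounded_of_comp (hl.symm ▸ hk), hl⟩

end IsCompletelyOpen

end CompleteBounds

/-! ### Subspaces, quotients and products of operator spaces -/

section Subspace

section MatrixNorm

variable {E : Type*} [AddCommGroup E] [Module ℂ E] [MatrixNorm E] (K : Submodule ℂ E)

/-- The matrix norm of a subspace, `M_n(K) ⊆ M_n(E)`. -/
instance : MatrixNorm K where
  mnorm n x := mnorm n (x.map K.subtype)

lemma mnorm_map_subtype {n : ℕ} (x : Matrix (Fin n) (Fin n) K) :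
    mnorm n (x.map K.subtype) = mnorm n x := rfl

lemma isCompletelyBounded_subtype : IsCompletelyBounded K.subtype :=
  ⟨1, fun _ _ => (one_mul _).ge⟩

lemma isCompletelyBoundedBelow_subtype : IsCompletelyBoundedBelow K.subtype :=
  ⟨1, fun _ _ => (one_mul _).ge⟩

end MatrixNorm

variable {E : Type*} [NormedAddCommGroup E] [NormedSpace ℂ E] [OperatorSpace E]

instance (K : Submodule ℂ E) [hK : IsClosed (K : Set E)] : OperatorSpace K where
  toCompleteSpace := hK.completeSpace_coe
  mnorm_add_le n x y := by
    simp only [← mnorm_map_subtype, Matrix.map_add _ (map_add K.subtype)]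
    exact mnorm_add_le n _ _
  mnorm_smul n c x := by
    simp only [← mnorm_map_subtype, Matrix.map_smul _ _ (map_smul K.subtype c)]
    exact mnorm_smul n _ _
  eq_zero_of_mnorm n x h :=
    Matrix.map_injective K.injective_subtype <|
      (eq_zero_of_mnorm n _ h).trans (Matrix.map_zero K.subtype (map_zero _)).symm
  mnorm_one x := mnorm_one (x : E)
  mnorm_directSum m n x y := by
    simp only [← mnorm_map_subtype]
    rw [← mnorm_directSum]
    exact congrArg _ (map_directSum K.subtype.toAddMonoidHom x y)
  mnorm_scalarMulMul_le n m α x β := by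
    simp only [← mnorm_map_subtype, map_scalarMulMul]
    exact mnorm_scalarMulMul_le n m _ _ _

end Subspace

section Quotient

variable {E : Type*} [NormedAddCommGroup E] [NormedSpace ℂ E] [OperatorSpace E]
  (K : Submodule ℂ E) {n : ℕ}

/-- The quotient matrix norm, `M_n(E / K) = M_n(E) / M_n(K)`. -/
noncomputable instance : MatrixNorm (E ⧸ K) where
  mnorm n x := ⨅ y : {y : Matrix (Fin n) (Fin n) E // y.map K.mkQ = x}, mnorm n y.1

instance (x : Matrix (Fin n) (Fin n) (E ⧸ K)) :
    Nonempty {y : Matrix (Fin n) (Fin n) E // y.map K.mkQ = x} :=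
  have ⟨s, hs⟩ := K.mkQ_surjective.hasRightInverse
  ⟨x.map s, by ext; exact hs _⟩

lemma mnorm_map_mkQ_le (y : Matrix (Fin n) (Fin n) E) : mnorm n (y.map K.mkQ) ≤ mnorm n y :=
  ciInf_le (f := fun z : {z : Matrix (Fin n) (Fin n) E // z.map K.mkQ = y.map K.mkQ} =>
    mnorm n z.1) ⟨0, Set.forall_mem_range.2 fun z => mnorm_nonneg n z.1⟩ ⟨y, rfl⟩

variable {K}

lemma exists_map_mkQ_eq_mnorm_lt (x : Matrix (Fin n) (Fin n) (E ⧸ K)) {r : ℝ}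
    (hr : mnorm n x < r) :
    ∃ y : Matrix (Fin n) (Fin n) E, y.map K.mkQ = x ∧ mnorm n y < r :=
  have ⟨⟨y, hyx⟩, hyr⟩ := exists_lt_of_ciInf_lt
    (ι := {y : Matrix (Fin n) (Fin n) E // y.map K.mkQ = x}) hr
  ⟨y, hyx, hyr⟩

lemma le_mnorm_quotient {x : Matrix (Fin n) (Fin n) (E ⧸ K)} {c : ℝ}
    (h : ∀ y : Matrix (Fin n) (Fin n) E, y.map K.mkQ = x → c ≤ mnorm n y) : c ≤ mnorm n x :=
  le_ciInf fun y => h y.1 y.2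

lemma le_mul_mnorm_quotient {x : Matrix (Fin n) (Fin n) (E ⧸ K)} {a c : ℝ} (ha : 0 ≤ a)
    (h : ∀ y : Matrix (Fin n) (Fin n) E, y.map K.mkQ = x → c ≤ a * mnorm n y) :
    c ≤ a * mnorm n x := calc
  c ≤ ⨅ y : {y : Matrix (Fin n) (Fin n) E // y.map K.mkQ = x}, a * mnorm n y.1 :=
    le_ciInf fun y => h y.1 y.2
  _ = a * mnorm n x := (Real.mul_iInf_of_nonneg ha _).symm

lemma mnorm_quotient_nonneg (x : Matrix (Fin n) (Fin n) (E ⧸ K)) : 0 ≤ mnorm n x :=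
  le_mnorm_quotient fun _ _ => mnorm_nonneg n _

lemma norm_apply_le_mnorm_quotient (x : Matrix (Fin n) (Fin n) (E ⧸ K)) (i j : Fin n) :
    ‖x i j‖ ≤ mnorm n x :=
  le_mnorm_quotient fun y hy => hy ▸
    (Submodule.Quotient.norm_mk_le K (y i j)).trans (norm_apply_le_mnorm y i j)

lemma mnorm_quotient_add_le (x y : Matrix (Fin n) (Fin n) (E ⧸ K)) :
    mnorm n (x + y) ≤ mnorm n x + mnorm n y :=
  le_ciInf_add_ciInf fun x' y' => calc
    mnorm n (x + y) = mnorm n ((x'.1 + y'.1).map K.mkQ) := by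
      rw [Matrix.map_add _ (map_add K.mkQ), x'.2, y'.2]
    _ ≤ mnorm n (x'.1 + y'.1) := mnorm_map_mkQ_le K _
    _ ≤ mnorm n x'.1 + mnorm n y'.1 := mnorm_add_le n _ _

lemma mnorm_quotient_smul_le (c : ℂ) (x : Matrix (Fin n) (Fin n) (E ⧸ K)) :
    mnorm n (c • x) ≤ ‖c‖ * mnorm n x := by
  refine le_mul_mnorm_quotient (norm_nonneg c) fun y hy => ?_
  rw [← hy, ← mnorm_smul, ← Matrix.map_smul _ _ (map_smul K.mkQ c)]
  exact mnorm_map_mkQ_le K _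

lemma mnorm_quotient_smul (c : ℂ) (x : Matrix (Fin n) (Fin n) (E ⧸ K)) :
    mnorm n (c • x) = ‖c‖ * mnorm n x := by
  refine (mnorm_quotient_smul_le c x).antisymm ?_
  rcases eq_or_ne c 0 with rfl | hc
  · simpa only [norm_zero, zero_mul] using mnorm_quotient_nonneg _
  · rw [← le_inv_mul_iff₀ (norm_pos_iff.2 hc), ← norm_inv]
    simpa only [inv_smul_smul₀ hc] using mnorm_quotient_smul_le c⁻¹ (c • x)

lemma mnorm_quotient_one (x : E ⧸ K) : mnorm 1 (Matrix.of fun _ _ : Fin 1 => x) = ‖x‖ := by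
  refine le_antisymm (le_of_forall_pos_le_add fun ε hε => ?_)
    (norm_apply_le_mnorm_quotient (Matrix.of fun _ _ : Fin 1 => x) 0 0)
  obtain ⟨y, rfl, hy⟩ := Submodule.Quotient.norm_mk_lt x hε
  rw [← mnorm_one y] at hy
  exact (mnorm_map_mkQ_le K (Matrix.of fun _ _ => y)).trans hy.le

lemma mnorm_quotient_submatrix_le {m : ℕ} {σ τ : Fin n → Fin m} (hσ : Function.Injective σ)
    (hτ : Function.Injective τ) (x : Matrix (Fin m) (Fin m) (E ⧸ K)) :
    mnorm n (x.submatrix σ τ) ≤ mnorm m x := by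
  refine le_mnorm_quotient fun y hy => ?_
  rw [← hy, Matrix.submatrix_map]
  exact (mnorm_map_mkQ_le K _).trans (mnorm_submatrix_le hσ hτ y)

lemma mnorm_quotient_directSum {m : ℕ} (x : Matrix (Fin m) (Fin m) (E ⧸ K))
    (y : Matrix (Fin n) (Fin n) (E ⧸ K)) :
    mnorm (m + n) (directSum x y) = max (mnorm m x) (mnorm n y) := by
  refine le_antisymm (le_of_forall_gt_imp_ge_of_dense fun r hr => ?_) (max_le ?_ ?_)
  · obtain ⟨x', rfl, hx⟩ := exists_map_mkQ_eq_mnorm_lt x ((le_max_left _ _).trans_lt hr)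
    obtain ⟨y', rfl, hy⟩ := exists_map_mkQ_eq_mnorm_lt y ((le_max_right _ _).trans_lt hr)
    calc mnorm (m + n) (directSum (x'.map K.mkQ) (y'.map K.mkQ))
        = mnorm (m + n) ((directSum x' y').map K.mkQ) :=
          congrArg _ (map_directSum K.mkQ.toAddMonoidHom x' y').symm
      _ ≤ mnorm (m + n) (directSum x' y') := mnorm_map_mkQ_le K _
      _ = max (mnorm m x') (mnorm n y') := mnorm_directSum m n x' y'
      _ ≤ r := (max_lt hx hy).le
  · simpa only [directSum_submatrix_castAdd] using mnorm_quotient_submatrix_le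
      (Fin.castAdd_injective m n) (Fin.castAdd_injective m n) (directSum x y)
  · simpa only [directSum_submatrix_natAdd] using mnorm_quotient_submatrix_le
      (Fin.natAdd_injective n m) (Fin.natAdd_injective n m) (directSum x y)

lemma mnorm_quotient_scalarMulMul_le {m : ℕ} (α : Matrix (Fin n) (Fin m) ℂ)
    (x : Matrix (Fin m) (Fin m) (E ⧸ K)) (β : Matrix (Fin m) (Fin n) ℂ) :
    mnorm n (scalarMulMul α x β) ≤ ‖α‖ * mnorm m x * ‖β‖ := by
  rw [mul_right_comm]
  refine le_mul_mnorm_quotient (by positivity) fun y hy => ?_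
  rw [← hy, ← map_scalarMulMul, mul_right_comm]
  exact (mnorm_map_mkQ_le K _).trans (mnorm_scalarMulMul_le n m α y β)

noncomputable instance [IsClosed (K : Set E)] : OperatorSpace (E ⧸ K) where
  toCompleteSpace := inferInstance
  mnorm_add_le _ := mnorm_quotient_add_le
  mnorm_smul _ := mnorm_quotient_smul
  eq_zero_of_mnorm _ x h := by
    ext i j
    exact norm_le_zero_iff.1 (h ▸ norm_apply_le_mnorm_quotient x i j)
  mnorm_one := mnorm_quotient_one
  mnorm_directSum _ _ := mnorm_quotient_directSum
  mnorm_scalarMulMul_le _ _ := mnorm_quotient_scalarMulMul_le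

variable (K)

lemma isCompletelyBounded_mkQ : IsCompletelyBounded K.mkQ :=
  ⟨1, fun _ y => (mnorm_map_mkQ_le K y).trans_eq (one_mul _).symm⟩

lemma isCompletelyOpen_mkQ [IsClosed (K : Set E)] : IsCompletelyOpen K.mkQ := by
  refine ⟨2, fun n x => ?_⟩
  rcases (mnorm_nonneg n x).eq_or_lt with h | h
  · refine ⟨0, (Matrix.map_zero K.mkQ (map_zero _)).trans (eq_zero_of_mnorm n x h.symm).symm, ?_⟩
    rw [← h, mul_zero, mnorm_zero]
  · obtain ⟨y, hy, hyx⟩ := exists_map_mkQ_eq_mnorm_lt x (lt_two_mul_self h)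
    exact ⟨y, hy, hyx.le⟩

end Quotient

section Prod

variable {E F G : Type*}

section MatrixNorm

variable [AddCommGroup E] [Module ℂ E] [MatrixNorm E] [AddCommGroup F] [Module ℂ F] [MatrixNorm F]

/-- The maximum matrix norm of a product. -/
noncomputable instance : MatrixNorm (E × F) where
  mnorm n x := max (mnorm n (x.map (LinearMap.fst ℂ E F))) (mnorm n (x.map (LinearMap.snd ℂ E F)))

lemma mnorm_prod {n : ℕ} (x : Matrix (Fin n) (Fin n) (E × F)) :
    mnorm n x =
      max (mnorm n (x.map (LinearMap.fst ℂ E F))) (mnorm n (x.map (LinearMap.snd ℂ E F))) := rfl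

lemma isCompletelyBounded_fst : IsCompletelyBounded (LinearMap.fst ℂ E F) :=
  ⟨1, fun _ _ => (le_max_left _ _).trans_eq (one_mul _).symm⟩

lemma isCompletelyBounded_snd : IsCompletelyBounded (LinearMap.snd ℂ E F) :=
  ⟨1, fun _ _ => (le_max_right _ _).trans_eq (one_mul _).symm⟩

lemma IsCompletelyBounded.prod [NormedAddCommGroup G] [NormedSpace ℂ G] [OperatorSpace G]
    {f : G →ₗ[ℂ] E} {g : G →ₗ[ℂ] F} (hf : IsCompletelyBounded f) (hg : IsCompletelyBounded g) :
    IsCompletelyBounded (f.prod g) := by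
  obtain ⟨C, hC⟩ := hf
  obtain ⟨D, hD⟩ := hg
  refine ⟨max C D, fun n x => max_le ((hC n x).trans ?_) ((hD n x).trans ?_)⟩
  · exact mul_le_mul_of_nonneg_right (le_max_left _ _) (mnorm_nonneg n x)
  · exact mul_le_mul_of_nonneg_right (le_max_right _ _) (mnorm_nonneg n x)

end MatrixNorm

variable [NormedAddCommGroup E] [NormedSpace ℂ E] [OperatorSpace E]
  [NormedAddCommGroup F] [NormedSpace ℂ F] [OperatorSpace F]

noncomputable instance : OperatorSpace (E × F) where
  toCompleteSpace := inferInstance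
  mnorm_add_le n x y := by
    simp only [mnorm_prod, Matrix.map_add _ (map_add (LinearMap.fst ℂ E F)),
      Matrix.map_add _ (map_add (LinearMap.snd ℂ E F))]
    exact (max_le_max (mnorm_add_le n _ _) (mnorm_add_le n _ _)).trans max_add_add_le_max_add_max
  mnorm_smul n c x := by
    simp only [mnorm_prod, Matrix.map_smul _ _ (map_smul (LinearMap.fst ℂ E F) c),
      Matrix.map_smul _ _ (map_smul (LinearMap.snd ℂ E F) c), mnorm_smul,
      mul_max_of_nonneg _ _ (norm_nonneg c)]
  eq_zero_of_mnorm n x h := by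
    have hfst := eq_zero_of_mnorm n _ (((le_max_left _ _).trans h.le).antisymm (mnorm_nonneg n _))
    have hsnd := eq_zero_of_mnorm n _ (((le_max_right _ _).trans h.le).antisymm (mnorm_nonneg n _))
    ext i j
    · exact congrFun (congrFun hfst i) j
    · exact congrFun (congrFun hsnd i) j
  mnorm_one x := congrArg₂ max (mnorm_one x.1) (mnorm_one x.2)
  mnorm_directSum m n x y := by
    simp only [mnorm_prod]
    rw [max_max_max_comm, ← mnorm_directSum, ← mnorm_directSum]
    exact congrArg₂ (fun a b => max (mnorm _ a) (mnorm _ b))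
      (map_directSum (AddMonoidHom.fst E F) x y) (map_directSum (AddMonoidHom.snd E F) x y)
  mnorm_scalarMulMul_le n m α x β := by
    simp only [mnorm_prod, map_scalarMulMul, mul_max_of_nonneg _ _ (norm_nonneg α),
      max_mul_of_nonneg _ _ (norm_nonneg β)]
    exact max_le_max (mnorm_scalarMulMul_le n m _ _ _) (mnorm_scalarMulMul_le n m _ _ _)

end Prod

instance : OperatorSpace PUnit.{u + 1} where
  mnorm _ _ := 0
  toCompleteSpace := inferInstance
  mnorm_add_le _ _ _ := (add_zero _).ge
  mnorm_smul _ _ _ := (mul_zero _).symm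
  eq_zero_of_mnorm _ _ _ := Subsingleton.elim _ _
  mnorm_one _ := norm_zero.symm
  mnorm_directSum _ _ _ _ := (max_self _).symm
  mnorm_scalarMulMul_le _ _ _ _ _ := by rw [mul_zero, zero_mul]

/-! ### Cobase change and base change estimates -/

section BaseChange

variable {E F G : Type*} [NormedAddCommGroup F] [NormedSpace ℂ F] [OperatorSpace F]

lemma IsCompletelyBoundedBelow.mkQ_comp_inr [NormedAddCommGroup E] [NormedSpace ℂ E]
    [OperatorSpace E] [NormedAddCommGroup G] [NormedSpace ℂ G] [OperatorSpace G]
    {f : E →ₗ[ℂ] F} {g : E →ₗ[ℂ] G} (hf : IsCompletelyBoundedBelow f)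
    (hg : IsCompletelyBounded g) :
    IsCompletelyBoundedBelow ((LinearMap.range (f.prod (-g))).mkQ ∘ₗ LinearMap.inr ℂ F G) := by
  -- A lift `y` of the image of `z` in the quotient is `(0, z) + (f x, - g x)` for some matrix `x`:
  -- its first component controls `x`, hence `g x`, and so `y` controls `z`.
  obtain ⟨C, hC⟩ := hf
  obtain ⟨D, hD⟩ := hg.exists_nnreal
  refine ⟨1 + D * C, fun n z => le_mul_mnorm_quotient (NNReal.coe_nonneg _) fun y hy => ?_⟩
  have exists_sub_eq (i j) : ∃ x, f.prod (-g) x = y i j - (0, z i j) :=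
    (Submodule.Quotient.eq _).1 (congrFun (congrFun hy i) j)
  choose x hx using exists_sub_eq
  have map_f_eq : (Matrix.of x).map f = y.map (LinearMap.fst ℂ F G) := by
    ext i j
    exact (congrArg Prod.fst (hx i j)).trans (sub_zero _)
  have z_eq : z = y.map (LinearMap.snd ℂ F G) + (Matrix.of x).map g := by
    ext i j
    have : -g (x i j) = (y i j).2 - z i j := congrArg Prod.snd (hx i j)
    change z i j = (y i j).2 + g (x i j)
    rw [← sub_neg_eq_add, this, sub_sub_cancel]
  have mnorm_map_g_le : mnorm n ((Matrix.of x).map g) ≤ D * (C * mnorm n y) := calc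
    _ ≤ D * mnorm n (Matrix.of x) := hD n _
    _ ≤ D * (C * mnorm n ((Matrix.of x).map f)) := by gcongr; exact hC n _
    _ ≤ D * (C * mnorm n y) := by gcongr; exact map_f_eq ▸ le_max_left _ _
  calc mnorm n z
      ≤ mnorm n (y.map (LinearMap.snd ℂ F G)) + mnorm n ((Matrix.of x).map g) := by
        conv_lhs => rw [z_eq]
        exact mnorm_add_le n _ _
    _ ≤ mnorm n y + D * (C * mnorm n y) := add_le_add (le_max_right _ _) mnorm_map_g_le
    _ = (1 + D * C : ℝ≥0) * mnorm n y := by push_cast; ring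

lemma IsCompletelyOpen.snd_comp_subtype [AddCommGroup E] [Module ℂ E] [MatrixNorm E]
    [AddCommGroup G] [Module ℂ G] [MatrixNorm G] {f : E →ₗ[ℂ] G} {g : F →ₗ[ℂ] G}
    (hf : IsCompletelyOpen f) (hg : IsCompletelyBounded g) :
    IsCompletelyOpen (LinearMap.snd ℂ E F ∘ₗ
      (LinearMap.ker (f ∘ₗ LinearMap.fst ℂ E F - g ∘ₗ LinearMap.snd ℂ E F)).subtype) := by
  obtain ⟨C, hC⟩ := hf
  obtain ⟨D, hD⟩ := hg.exists_nnreal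
  refine ⟨max (C * D) 1, fun n y => ?_⟩
  obtain ⟨x, hx, hxy⟩ := hC n (y.map g)
  have mem_ker (i j) : (x i j, y i j) ∈
      LinearMap.ker (f ∘ₗ LinearMap.fst ℂ E F - g ∘ₗ LinearMap.snd ℂ E F) :=
    sub_eq_zero.2 (congrFun (congrFun hx i) j)
  have hy := mnorm_nonneg n y
  refine ⟨Matrix.of fun i j => ⟨(x i j, y i j), mem_ker i j⟩, rfl, max_le ?_ ?_⟩
  · calc mnorm n x ≤ C * mnorm n (y.map g) := hxy
      _ ≤ C * (D * mnorm n y) := by gcongr; exact hD n y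
      _ = (C * D : ℝ≥0) * mnorm n y := by rw [NNReal.coe_mul, mul_assoc]
      _ ≤ (max (C * D) 1 : ℝ≥0) * mnorm n y := by gcongr; exact le_max_left _ _
  · exact le_mul_of_one_le_left hy (NNReal.one_le_coe.2 (le_max_right _ _))

end BaseChange

/-! ### Kernel–cokernel pairs -/

section KernelCokernelPairs

variable {C : Type*} [Category* C] [Preadditive C]

lemma IsKernelCokernelPair.of_iso {S T : ShortComplex C} (e : S ≅ T)
    (h : IsKernelCokernelPair S) : IsKernelCokernelPair T :=
  ⟨⟨IsKernel.ofIso _ h.1.some _ (ShortComplex.π₂.mapIso e) (ShortComplex.π₃.mapIso e)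
      (ShortComplex.π₁.mapIso e) e.hom.comm₂₃ e.hom.comm₁₂⟩,
    ⟨IsCokernel.ofIso _ h.2.some _ (ShortComplex.π₁.mapIso e) (ShortComplex.π₂.mapIso e)
      (ShortComplex.π₃.mapIso e) e.hom.comm₁₂ e.hom.comm₂₃⟩⟩

lemma nonempty_iso_of_isColimit {S : ShortComplex C}
    (hS : IsColimit (CokernelCofork.ofπ S.g S.zero)) {c : CokernelCofork S.f}
    (hc : IsColimit c) : Nonempty (S ≅ ShortComplex.mk S.f c.π c.condition) :=
  ⟨ShortComplex.isoMk (Iso.refl _) (Iso.refl _) (hS.coconePointUniqueUpToIso hc)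
    (by simp) (by simpa using (hS.comp_coconePointUniqueUpToIso_hom hc .one).symm)⟩

lemma nonempty_iso_of_isLimit {S : ShortComplex C}
    (hS : IsLimit (KernelFork.ofι S.f S.zero)) {c : KernelFork S.g}
    (hc : IsLimit c) : Nonempty (S ≅ ShortComplex.mk c.ι S.g c.condition) :=
  ⟨ShortComplex.isoMk (hS.conePointUniqueUpToIso hc) (Iso.refl _) (Iso.refl _)
    (by simpa using hS.conePointUniqueUpToIso_hom_comp hc .zero) (by simp)⟩

end KernelCokernelPairs

/-! ### The split exact structure -/

section Split

variable {C : Type*} [Category* C] [Preadditive C]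

lemma isPushout_of_splitting {S : ShortComplex C} (s : S.Splitting) {Z : C} (g : S.X₁ ⟶ Z)
    [HasBinaryBiproduct Z S.X₃] :
    IsPushout S.f g (biprod.lift (s.r ≫ g) S.g) biprod.inl where
  w := by ext <;> simp
  isColimit' := ⟨PushoutCocone.IsColimit.mk _
    (fun c => biprod.desc c.inr (s.s ≫ c.inl))
    (fun c => by
      rw [biprod.lift_desc, Category.assoc, ← c.condition, ← Category.assoc, ← Category.assoc,
        ← Preadditive.add_comp, s.id, Category.id_comp])
    (fun c => by simp)
    (fun c m hl hr => by
      have : biprod.inr = s.s ≫ biprod.lift (s.r ≫ g) S.g := by ext <;> simp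
      ext
      · simpa using hr
      · rw [this, Category.assoc, hl, ← this, biprod.inr_desc])⟩

lemma isPullback_of_splitting {S : ShortComplex C} (s : S.Splitting) {Z : C} (g : Z ⟶ S.X₃)
    [HasBinaryBiproduct S.X₁ Z] :
    IsPullback (biprod.desc S.f (g ≫ s.s)) biprod.snd S.g g where
  w := by ext <;> simp
  isLimit' := ⟨PullbackCone.IsLimit.mk _
    (fun c => biprod.lift (c.fst ≫ s.r) c.snd)
    (fun c => by
      rw [biprod.lift_desc, Category.assoc, ← Category.assoc c.snd, ← c.condition, Category.assoc,
        ← Preadditive.comp_add, s.id, Category.comp_id])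
    (fun c => by simp)
    (fun c m hl hr => by
      have : biprod.fst = biprod.desc S.f (g ≫ s.s) ≫ s.r := by ext <;> simp
      ext
      · rw [biprod.lift_fst, this, ← Category.assoc, hl]
      · simpa using hr)⟩

variable [HasZeroObject C]

lemma Emin_of_splitting {S : ShortComplex C} (s : S.Splitting) : Emin C S :=
  ⟨⟨⟨s.fIsKernel⟩, ⟨s.gIsCokernel⟩⟩, ⟨s⟩⟩

lemma admissibleMono_Emin_iff {X Y : C} (f : X ⟶ Y) :
    AdmissibleMono (Emin C) f ↔
      ∃ (Z : C) (π : Y ⟶ Z) (w : f ≫ π = 0), Nonempty (ShortComplex.mk f π w).Splitting :=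
  ⟨fun ⟨Z, π, w, h⟩ => ⟨Z, π, w, h.2⟩, fun ⟨Z, π, w, ⟨s⟩⟩ => ⟨Z, π, w, Emin_of_splitting s⟩⟩

lemma admissibleEpi_Emin_iff {Y Z : C} (g : Y ⟶ Z) :
    AdmissibleEpi (Emin C) g ↔
      ∃ (X : C) (ι : X ⟶ Y) (w : ι ≫ g = 0), Nonempty (ShortComplex.mk ι g w).Splitting :=
  ⟨fun ⟨X, ι, w, h⟩ => ⟨X, ι, w, h.2⟩, fun ⟨X, ι, w, ⟨s⟩⟩ => ⟨X, ι, w, Emin_of_splitting s⟩⟩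

section BinaryBiproducts

variable [HasBinaryBiproducts C]

lemma AdmissibleMono.comp_Emin {X Y Z : C} {f : X ⟶ Y} {g : Y ⟶ Z}
    (hf : AdmissibleMono (Emin C) f) (hg : AdmissibleMono (Emin C) g) :
    AdmissibleMono (Emin C) (f ≫ g) := by
  rw [admissibleMono_Emin_iff] at hf hg ⊢
  obtain ⟨A, π, wf, ⟨s⟩⟩ := hf
  obtain ⟨B, ρ, wg, ⟨t⟩⟩ := hg
  refine ⟨A ⊞ B, biprod.lift (t.r ≫ π) ρ, by ext <;> simp [t.f_r_assoc π, wf, wg],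
    ⟨{ r := t.r ≫ s.r, s := biprod.desc (s.s ≫ g) t.s, f_r := ?_, s_g := ?_, id := ?_ }⟩⟩
  · simp [t.f_r_assoc s.r, s.f_r]
  · ext <;> simp [t.f_r_assoc π, t.s_r_assoc π, s.s_g, t.s_g, wg]
  · calc (t.r ≫ s.r) ≫ f ≫ g + biprod.lift (t.r ≫ π) ρ ≫ biprod.desc (s.s ≫ g) t.s
      _ = t.r ≫ (s.r ≫ f + π ≫ s.s) ≫ g + ρ ≫ t.s := by simp [add_assoc]
      _ = 𝟙 Z := by simpa [s.id] using t.id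

lemma AdmissibleEpi.comp_Emin {X Y Z : C} {f : X ⟶ Y} {g : Y ⟶ Z}
    (hf : AdmissibleEpi (Emin C) f) (hg : AdmissibleEpi (Emin C) g) :
    AdmissibleEpi (Emin C) (f ≫ g) := by
  rw [admissibleEpi_Emin_iff] at hf hg ⊢
  obtain ⟨A, ι, wf, ⟨s⟩⟩ := hf
  obtain ⟨B, κ, wg, ⟨t⟩⟩ := hg
  refine ⟨A ⊞ B, biprod.desc ι (κ ≫ s.s), by ext <;> simp [s.s_g_assoc g, reassoc_of% wf, wg],
    ⟨{ r := biprod.lift s.r (f ≫ t.r), s := t.s ≫ s.s, f_r := ?_, s_g := ?_, id := ?_ }⟩⟩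
  · ext <;> simp [s.s_g_assoc t.r, reassoc_of% wf, s.f_r, s.s_r, t.f_r]
  · simp [s.s_g_assoc g, t.s_g]
  · calc biprod.lift s.r (f ≫ t.r) ≫ biprod.desc ι (κ ≫ s.s) + (f ≫ g) ≫ t.s ≫ s.s
      _ = s.r ≫ ι + f ≫ (t.r ≫ κ + g ≫ t.s) ≫ s.s := by simp [add_assoc]
      _ = 𝟙 X := by simpa [t.id] using s.id

end BinaryBiproducts

lemma AdmissibleMono.of_isPushout_Emin {X Y Z P : C} {f : X ⟶ Y} {g : X ⟶ Z} {inl : Y ⟶ P}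
    {inr : Z ⟶ P} (h : IsPushout f g inl inr) (hf : AdmissibleMono (Emin C) f) :
    AdmissibleMono (Emin C) inr := by
  rw [admissibleMono_Emin_iff] at hf ⊢
  obtain ⟨A, π, w, ⟨s⟩⟩ := hf
  refine ⟨A, h.desc π 0 (by simp [w]), h.inr_desc _ _ _, ⟨
    { r := h.desc (s.r ≫ g) (𝟙 Z) (by simpa using s.f_r_assoc g)
      s := s.s ≫ inl
      f_r := h.inr_desc _ _ _
      s_g := by simpa using s.s_g
      id := h.hom_ext ?_ (by simp) }⟩⟩
  calc inl ≫ (h.desc (s.r ≫ g) (𝟙 Z) _ ≫ inr + h.desc π 0 _ ≫ s.s ≫ inl)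
    _ = (s.r ≫ f + π ≫ s.s) ≫ inl := by simp [h.w]
    _ = inl ≫ 𝟙 P := by simp [s.id]

lemma AdmissibleEpi.of_isPullback_Emin {X Y Z P : C} {f : X ⟶ Z} {g : Y ⟶ Z} {fst : P ⟶ X}
    {snd : P ⟶ Y} (h : IsPullback fst snd f g) (hf : AdmissibleEpi (Emin C) f) :
    AdmissibleEpi (Emin C) snd := by
  rw [admissibleEpi_Emin_iff] at hf ⊢
  obtain ⟨A, ι, w, ⟨s⟩⟩ := hf
  refine ⟨A, h.lift ι 0 (by simp [w]), h.lift_snd _ _ _, ⟨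
    { r := fst ≫ s.r
      s := h.lift (g ≫ s.s) (𝟙 Y) (by simp [s.s_g])
      f_r := by simpa using s.f_r
      s_g := h.lift_snd _ _ _
      id := h.hom_ext ?_ (by simp) }⟩⟩
  calc ((fst ≫ s.r) ≫ h.lift ι 0 _ + snd ≫ h.lift (g ≫ s.s) (𝟙 Y) _) ≫ fst
    _ = fst ≫ (s.r ≫ ι + f ≫ s.s) := by simp [h.w_assoc]
    _ = 𝟙 P ≫ fst := by simp [s.id]

open scoped ZeroObject in
variable (C) in
theorem isExactCategory_Emin [HasBinaryProducts C] : IsExactCategory (Emin C) where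
  hasZeroObject := inferInstance
  hasBinaryProducts := inferInstance
  isExactStructure :=
    have := HasBinaryBiproducts.of_hasBinaryProducts (C := C)
    { isKernelCokernelPair := fun _ h => h.1
      of_iso := fun _ _ ⟨e⟩ h => ⟨h.1.of_iso e, ⟨h.2.some.ofIso e⟩⟩
      id_mono := fun X => (admissibleMono_Emin_iff _).2
        ⟨0, 0, comp_zero, ⟨.ofIsIsoOfIsZero _ (inferInstanceAs (IsIso (𝟙 X))) (isZero_zero C)⟩⟩
      id_epi := fun X => (admissibleEpi_Emin_iff _).2
        ⟨0, 0, zero_comp, ⟨.ofIsZeroOfIsIso _ (isZero_zero C) (inferInstanceAs (IsIso (𝟙 X)))⟩⟩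
      comp_mono := fun _ _ => .comp_Emin
      comp_epi := fun _ _ => .comp_Emin
      pushout := fun _ g ⟨_, _, _, h⟩ =>
        ⟨(isPushout_of_splitting h.2.some g).hasPushout,
          fun _ _ hP => .of_isPushout_Emin hP ⟨_, _, _, h⟩⟩
      pullback := fun _ g ⟨_, _, _, h⟩ =>
        ⟨(isPullback_of_splitting h.2.some g).hasPullback,
          fun _ _ hP => .of_isPullback_Emin hP ⟨_, _, _, h⟩⟩ }

end Split

/-! ### Inverse images of exact structures -/

section InverseImage

variable {C D : Type*} [Category* C] [Preadditive C] [Category* D] [Preadditive D]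

lemma hasPullbacks_of_hasKernels [HasBinaryProducts C] [HasKernels C] : HasPullbacks C :=
  have := Preadditive.hasEqualizers_of_hasKernels (C := C)
  hasPullbacks_of_hasBinaryProducts_of_hasEqualizers C

lemma hasPushouts_of_hasCokernels [HasBinaryProducts C] [HasCokernels C] : HasPushouts C :=
  have := Preadditive.hasCoequalizers_of_hasCokernels (C := C)
  have := HasBinaryBiproducts.of_hasBinaryProducts (C := C)
  hasPushouts_of_hasBinaryCoproducts_of_hasCoequalizers C

variable (U : C ⥤ D) [U.Additive]

lemma preservesFiniteLimits_of_preserves_kernels [HasZeroObject C] [HasBinaryProducts C]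
    [HasKernels C] [∀ {X Y : C} (f : X ⟶ Y), PreservesLimit (parallelPair f 0) U] :
    PreservesFiniteLimits U :=
  have := Preadditive.hasEqualizers_of_hasKernels (C := C)
  have := HasBinaryBiproducts.of_hasBinaryProducts (C := C)
  have := hasFiniteProducts_of_has_binary_and_terminal (C := C)
  have : HasZeroObject D := (U.map_isZero (isZero_zero C)).hasZeroObject
  U.preservesFiniteLimits_of_preservesKernels

lemma preservesFiniteColimits_of_preserves_cokernels [HasZeroObject C] [HasBinaryProducts C]
    [HasCokernels C] [∀ {X Y : C} (f : X ⟶ Y), PreservesColimit (parallelPair f 0) U] :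
    PreservesFiniteColimits U :=
  have := Preadditive.hasCoequalizers_of_hasCokernels (C := C)
  have := HasBinaryBiproducts.of_hasBinaryProducts (C := C)
  have := hasFiniteCoproducts_of_has_binary_and_initial (C := C)
  have : HasZeroObject D := (U.map_isZero (isZero_zero C)).hasZeroObject
  U.preservesFiniteColimits_of_preservesCokernels

lemma isKernelCokernelPair_map_iff [U.ReflectsIsomorphisms] [HasKernels C] [HasCokernels C]
    [∀ {X Y : C} (f : X ⟶ Y), PreservesLimit (parallelPair f 0) U]
    [∀ {X Y : C} (f : X ⟶ Y), PreservesColimit (parallelPair f 0) U] (S : ShortComplex C) :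
    IsKernelCokernelPair (S.map U) ↔ IsKernelCokernelPair S :=
  have := reflectsLimit_of_reflectsIsomorphisms (parallelPair S.g 0) U
  have := reflectsColimit_of_reflectsIsomorphisms (parallelPair S.f 0) U
  ⟨fun ⟨⟨hk⟩, ⟨hc⟩⟩ =>
      ⟨⟨isLimitOfReflects U ((KernelFork.ofι S.f S.zero).isLimitMapConeEquiv U |>.symm hk)⟩,
        ⟨isColimitOfReflects U
          ((CokernelCofork.ofπ S.g S.zero).isColimitMapCoconeEquiv U |>.symm hc)⟩⟩,
    fun ⟨⟨hk⟩, ⟨hc⟩⟩ => ⟨⟨KernelFork.mapIsLimit _ hk U⟩, ⟨CokernelCofork.mapIsColimit _ hc U⟩⟩⟩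

lemma Emax_eq_inverseImage [U.ReflectsIsomorphisms] [HasKernels C] [HasCokernels C]
    [∀ {X Y : C} (f : X ⟶ Y), PreservesLimit (parallelPair f 0) U]
    [∀ {X Y : C} (f : X ⟶ Y), PreservesColimit (parallelPair f 0) U] :
    Emax C = (Emax D).inverseImage U.mapShortComplex :=
  funext fun S => propext (isKernelCokernelPair_map_iff U S).symm

variable {E : ObjectProperty (ShortComplex D)}

lemma relativeClass_Emax_eq_inverseImage [U.ReflectsIsomorphisms] [HasKernels C] [HasCokernels C]
    [∀ {X Y : C} (f : X ⟶ Y), PreservesLimit (parallelPair f 0) U]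
    [∀ {X Y : C} (f : X ⟶ Y), PreservesColimit (parallelPair f 0) U] (hE : E ≤ Emax D) :
    relativeClass U (Emax C) E = E.inverseImage U.mapShortComplex :=
  funext fun S => propext
    ⟨And.right, fun h => ⟨(isKernelCokernelPair_map_iff U S).1 (hE _ h), h⟩⟩

lemma admissibleMono_inverseImage_iff (hE : IsExactStructure E) [HasCokernels C]
    [∀ {X Y : C} (f : X ⟶ Y), PreservesColimit (parallelPair f 0) U] {X Y : C} (f : X ⟶ Y) :
    AdmissibleMono (E.inverseImage U.mapShortComplex) f ↔ AdmissibleMono E (U.map f) := by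
  refine ⟨fun ⟨Z, π, w, h⟩ => ⟨_, U.map π, _, h⟩, fun ⟨Z, π, w, h⟩ =>
    ⟨_, cokernel.π f, cokernel.condition f, hE.of_iso _ _ ?_ h⟩⟩
  exact nonempty_iso_of_isColimit (hE.isKernelCokernelPair _ h).2.some
    (CokernelCofork.mapIsColimit _ (cokernelIsCokernel f) U)

lemma admissibleEpi_inverseImage_iff (hE : IsExactStructure E) [HasKernels C]
    [∀ {X Y : C} (f : X ⟶ Y), PreservesLimit (parallelPair f 0) U] {X Y : C} (f : X ⟶ Y) :
    AdmissibleEpi (E.inverseImage U.mapShortComplex) f ↔ AdmissibleEpi E (U.map f) := by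
  refine ⟨fun ⟨Z, ι, w, h⟩ => ⟨_, U.map ι, _, h⟩, fun ⟨Z, ι, w, h⟩ =>
    ⟨_, kernel.ι f, kernel.condition f, hE.of_iso _ _ ?_ h⟩⟩
  exact nonempty_iso_of_isLimit (hE.isKernelCokernelPair _ h).1.some
    (KernelFork.mapIsLimit _ (kernelIsKernel f) U)

theorem isExactCategory_inverseImage (hE : IsExactStructure E) [U.ReflectsIsomorphisms]
    [HasZeroObject C] [HasBinaryProducts C] [HasKernels C] [HasCokernels C]
    [∀ {X Y : C} (f : X ⟶ Y), PreservesLimit (parallelPair f 0) U]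
    [∀ {X Y : C} (f : X ⟶ Y), PreservesColimit (parallelPair f 0) U] :
    IsExactCategory (E.inverseImage U.mapShortComplex) where
  hasZeroObject := inferInstance
  hasBinaryProducts := inferInstance
  isExactStructure :=
    have hmono {X Y : C} (f : X ⟶ Y) := admissibleMono_inverseImage_iff U hE f
    have hepi {X Y : C} (f : X ⟶ Y) := admissibleEpi_inverseImage_iff U hE f
    { isKernelCokernelPair := fun S h =>
        (isKernelCokernelPair_map_iff U S).1 (hE.isKernelCokernelPair _ h)
      of_iso := fun _ _ ⟨e⟩ h => hE.of_iso _ _ ⟨U.mapShortComplex.mapIso e⟩ h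
      id_mono := fun X => (hmono _).2 (U.map_id X ▸ hE.id_mono _)
      id_epi := fun X => (hepi _).2 (U.map_id X ▸ hE.id_epi _)
      comp_mono := fun f g hf hg => (hmono _).2
        (U.map_comp f g ▸ hE.comp_mono _ _ ((hmono f).1 hf) ((hmono g).1 hg))
      comp_epi := fun f g hf hg => (hepi _).2
        (U.map_comp f g ▸ hE.comp_epi _ _ ((hepi f).1 hf) ((hepi g).1 hg))
      pushout := fun f g hf =>
        have := hasPushouts_of_hasCokernels (C := C)
        have := preservesFiniteColimits_of_preserves_cokernels U
        ⟨inferInstance, fun _ _ h =>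
          (hmono _).2 ((hE.pushout _ (U.map g) ((hmono f).1 hf)).2 _ _ (h.map U))⟩
      pullback := fun f g hf =>
        have := hasPullbacks_of_hasKernels (C := C)
        have := preservesFiniteLimits_of_preserves_kernels U
        ⟨inferInstance, fun _ _ h =>
          (hepi _).2 ((hE.pullback _ (U.map g) ((hepi f).1 hf)).2 _ _ (h.map U))⟩ }

end InverseImage

/-! ### The category of operator spaces -/

namespace Op

/-- The linear map underlying a morphism of operator spaces. -/
def toLin {X Y : Op.{u}} (f : X ⟶ Y) : X.carrier →ₗ[ℂ] Y.carrier := Subtype.val f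

/-- A completely bounded map as a morphism of operator spaces. -/
def ofHom {X Y : Op.{u}} (f : X.carrier →ₗ[ℂ] Y.carrier) (hf : IsCompletelyBounded f) :
    X ⟶ Y := ⟨f, hf⟩

variable {X Y Z : Op.{u}}

lemma isCompletelyBounded_toLin (f : X ⟶ Y) : IsCompletelyBounded (toLin f) := Subtype.property f

lemma hom_ext {f g : X ⟶ Y} (h : toLin f = toLin g) : f = g := Subtype.ext h

lemma toLin_comp (f : X ⟶ Y) (g : Y ⟶ Z) : toLin (f ≫ g) = toLin g ∘ₗ toLin f := rfl

lemma toLin_comp_eq_zero {f : X ⟶ Y} {g : Y ⟶ Z} (w : f ≫ g = 0) : toLin g ∘ₗ toLin f = 0 :=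
  congrArg toLin w

lemma mono_of_injective {f : X ⟶ Y} (hf : Function.Injective (toLin f)) : Mono f :=
  ⟨fun _ _ h => hom_ext (LinearMap.cancel_left hf |>.1 (congrArg toLin h))⟩

lemma epi_of_surjective {f : X ⟶ Y} (hf : Function.Surjective (toLin f)) : Epi f :=
  ⟨fun _ _ h => hom_ext (LinearMap.cancel_right hf |>.1 (congrArg toLin h))⟩

lemma isCompletelyBoundedBelow_hom (e : X ≅ Y) : IsCompletelyBoundedBelow (toLin e.hom) :=
  .of_comp (g := toLin e.inv) (by rw [← toLin_comp, e.hom_inv_id]; exact .id)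
    (isCompletelyBounded_toLin e.inv)

lemma isCompletelyOpen_hom (e : X ≅ Y) : IsCompletelyOpen (toLin e.hom) :=
  .of_comp (f := toLin e.inv) (by rw [← toLin_comp, e.inv_hom_id]; exact .id)
    (isCompletelyBounded_toLin e.inv)

lemma nonempty_isLimit_kernelFork {f : X ⟶ Y} {g : Y ⟶ Z} (w : f ≫ g = 0)
    (hf : IsCompletelyBoundedBelow (toLin f))
    (h : LinearMap.ker (toLin g) ≤ LinearMap.range (toLin f)) :
    Nonempty (IsLimit (KernelFork.ofι f w)) := by
  have := mono_of_injective hf.injective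
  have exists_lift {W : Op.{u}} (k : W ⟶ Y) (hk : k ≫ g = 0) : ∃ l : W ⟶ X, l ≫ f = k :=
    have ⟨l, hl, hlf⟩ := hf.exists_lift (isCompletelyBounded_toLin k)
      ((LinearMap.range_le_ker_iff.2 (toLin_comp_eq_zero hk)).trans h)
    ⟨ofHom l hl, hom_ext hlf⟩
  choose l hl using @exists_lift
  exact ⟨KernelFork.IsLimit.ofι' _ _ fun k hk => ⟨l k hk, hl k hk⟩⟩

lemma nonempty_isColimit_cokernelCofork {f : X ⟶ Y} {g : Y ⟶ Z} (w : f ≫ g = 0)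
    (hg : IsCompletelyOpen (toLin g))
    (h : LinearMap.ker (toLin g) ≤ (LinearMap.range (toLin f)).topologicalClosure) :
    Nonempty (IsColimit (CokernelCofork.ofπ g w)) := by
  have := epi_of_surjective hg.surjective
  have exists_desc {W : Op.{u}} (k : Y ⟶ W) (hk : f ≫ k = 0) : ∃ l : Z ⟶ W, g ≫ l = k :=
    have ⟨l, hl, hlg⟩ := hg.exists_desc (isCompletelyBounded_toLin k)
      (h.trans ((LinearMap.range (toLin f)).topologicalClosure_minimal
        (LinearMap.range_le_ker_iff.2 (toLin_comp_eq_zero hk))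
        (isCompletelyBounded_toLin k).isClosed_ker))
    ⟨ofHom l hl, hom_ext hlg⟩
  choose l hl using @exists_desc
  exact ⟨CokernelCofork.IsColimit.ofπ' _ _ fun k hk => ⟨l k hk, hl k hk⟩⟩

instance (f : X ⟶ Y) : IsClosed (LinearMap.ker (toLin f) : Set X.carrier) :=
  (isCompletelyBounded_toLin f).isClosed_ker

instance (f : X ⟶ Y) :
    IsClosed ((LinearMap.range (toLin f)).topologicalClosure : Set Y.carrier) :=
  Submodule.isClosed_topologicalClosure _

/-- The kernel of a completely bounded map, with the subspace matrix norms. -/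
noncomputable def kernelFork (f : X ⟶ Y) : KernelFork f :=
  KernelFork.ofι (ofHom (X := ⟨LinearMap.ker (toLin f)⟩) (LinearMap.ker (toLin f)).subtype
    (isCompletelyBounded_subtype _)) (hom_ext (LinearMap.comp_ker_subtype _))

lemma nonempty_isLimit (f : X ⟶ Y) : Nonempty (IsLimit (kernelFork f)) :=
  nonempty_isLimit_kernelFork (kernelFork f).condition (isCompletelyBoundedBelow_subtype _)
    (Submodule.range_subtype _).ge

/-- The cokernel of a completely bounded map: the quotient by the closure of its range. -/
noncomputable def cokernelCofork (f : X ⟶ Y) : CokernelCofork f :=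
  CokernelCofork.ofπ (ofHom
      (Y := ⟨Y.carrier ⧸ (LinearMap.range (toLin f)).topologicalClosure⟩)
      (LinearMap.range (toLin f)).topologicalClosure.mkQ (isCompletelyBounded_mkQ _))
    (hom_ext (LinearMap.range_le_ker_iff.1
      ((LinearMap.range (toLin f)).le_topologicalClosure.trans (Submodule.ker_mkQ _).ge)))

lemma nonempty_isColimit (f : X ⟶ Y) : Nonempty (IsColimit (cokernelCofork f)) :=
  nonempty_isColimit_cokernelCofork (cokernelCofork f).condition (isCompletelyOpen_mkQ _)
    (Submodule.ker_mkQ _).le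

instance : HasKernels Op.{u} := ⟨fun f => ⟨_, (nonempty_isLimit f).some⟩⟩

instance : HasCokernels Op.{u} := ⟨fun f => ⟨_, (nonempty_isColimit f).some⟩⟩

instance : HasZeroObject Op.{u} :=
  ⟨⟨PUnit⟩, (IsZero.iff_id_eq_zero _).2 (hom_ext (LinearMap.ext fun _ => rfl))⟩

/-- The product of two operator spaces as a biproduct. -/
noncomputable def prodBicone (X Y : Op.{u}) : BinaryBicone X Y where
  pt := ⟨X.carrier × Y.carrier⟩
  fst := ofHom (LinearMap.fst ℂ _ _) isCompletelyBounded_fst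
  snd := ofHom (LinearMap.snd ℂ _ _) isCompletelyBounded_snd
  inl := ofHom (LinearMap.inl ℂ _ _) (.prod (id_mem_CB _) (CB _ _).zero_mem)
  inr := ofHom (LinearMap.inr ℂ _ _) (.prod (CB _ _).zero_mem (id_mem_CB _))

instance : HasBinaryBiproducts Op.{u} where
  has_binary_biproduct X Y := hasBinaryBiproduct_of_total (prodBicone X Y)
    (hom_ext (LinearMap.ext fun x => Prod.ext (add_zero x.1) (zero_add x.2)))

/-! ### The maximal exact structure on operator spaces -/

lemma isCompletelyBoundedBelow_of_isLimit {g : Y ⟶ Z} {c : KernelFork g} (hc : IsLimit c) :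
    IsCompletelyBoundedBelow (toLin c.ι) := by
  obtain ⟨hk⟩ := nonempty_isLimit g
  have ι_eq : (hc.conePointUniqueUpToIso hk).hom ≫ (kernelFork g).ι = c.ι :=
    hc.conePointUniqueUpToIso_hom_comp hk .zero
  rw [← ι_eq]
  exact (isCompletelyBoundedBelow_subtype _).comp (isCompletelyBoundedBelow_hom _)

lemma isCompletelyOpen_of_isColimit {f : X ⟶ Y} {c : CokernelCofork f} (hc : IsColimit c) :
    IsCompletelyOpen (toLin c.π) := by
  obtain ⟨hk⟩ := nonempty_isColimit f
  have π_eq : (cokernelCofork f).π ≫ (hk.coconePointUniqueUpToIso hc).hom = c.π :=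
    hk.comp_coconePointUniqueUpToIso_hom hc .one
  rw [← π_eq]
  exact (isCompletelyOpen_hom _).comp (isCompletelyOpen_mkQ _)

lemma admissibleMono_Emax_iff (f : X ⟶ Y) :
    AdmissibleMono (Emax Op.{u}) f ↔ IsCompletelyBoundedBelow (toLin f) := by
  refine ⟨fun ⟨Z, π, w, ⟨⟨h⟩, _⟩⟩ => isCompletelyBoundedBelow_of_isLimit h, fun hf => ?_⟩
  have ker_le : LinearMap.ker (toLin (cokernelCofork f).π) ≤ LinearMap.range (toLin f) :=
    ((Submodule.ker_mkQ _).trans (hf.isClosed_range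
      (isCompletelyBounded_toLin f)).submodule_topologicalClosure_eq).le
  exact ⟨_, _, (cokernelCofork f).condition, nonempty_isLimit_kernelFork _ hf ker_le,
    nonempty_isColimit f⟩

lemma admissibleEpi_Emax_iff (f : X ⟶ Y) :
    AdmissibleEpi (Emax Op.{u}) f ↔ IsCompletelyOpen (toLin f) := by
  refine ⟨fun ⟨Z, ι, w, ⟨_, ⟨h⟩⟩⟩ => isCompletelyOpen_of_isColimit h, fun hf => ?_⟩
  have ker_le : LinearMap.ker (toLin f) ≤
      (LinearMap.range (toLin (kernelFork f).ι)).topologicalClosure :=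
    (Submodule.range_subtype _).ge.trans (Submodule.le_topologicalClosure _)
  exact ⟨_, _, (kernelFork f).condition, nonempty_isLimit f,
    nonempty_isColimit_cokernelCofork _ hf ker_le⟩

lemma isCompletelyBoundedBelow_of_isPushout {P : Op.{u}} {f : X ⟶ Y} {g : X ⟶ Z}
    {inl : Y ⟶ P} {inr : Z ⟶ P} (h : IsPushout f g inl inr)
    (hf : IsCompletelyBoundedBelow (toLin f)) : IsCompletelyBoundedBelow (toLin inr) := by
  let T := (toLin f).prod (-toLin g)
  have T_cb : IsCompletelyBounded T :=
    (isCompletelyBounded_toLin f).prod ((CB _ _).neg_mem (isCompletelyBounded_toLin g))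
  have T_below : IsCompletelyBoundedBelow T :=
    .of_comp (g := LinearMap.fst ℂ _ _) hf isCompletelyBounded_fst
  have := T_below.isClosed_range T_cb
  let q : (prodBicone Y Z).pt ⟶ ⟨(Y.carrier × Z.carrier) ⧸ LinearMap.range T⟩ :=
    ofHom (LinearMap.range T).mkQ (isCompletelyBounded_mkQ _)
  have w : f ≫ (prodBicone Y Z).inl ≫ q = g ≫ (prodBicone Y Z).inr ≫ q :=
    hom_ext <| LinearMap.ext fun x => (Submodule.Quotient.eq _).2 ⟨x, Prod.ext
      (sub_zero (toLin f x)).symm (zero_sub (toLin g x)).symm⟩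
  have inr_q : IsCompletelyBoundedBelow (toLin ((prodBicone Y Z).inr ≫ q)) :=
    hf.mkQ_comp_inr (isCompletelyBounded_toLin g)
  rw [← h.inr_desc _ _ w] at inr_q
  exact inr_q.of_comp (isCompletelyBounded_toLin _)

lemma isCompletelyOpen_of_isPullback {P : Op.{u}} {f : X ⟶ Z} {g : Y ⟶ Z}
    {fst : P ⟶ X} {snd : P ⟶ Y} (h : IsPullback fst snd f g)
    (hf : IsCompletelyOpen (toLin f)) : IsCompletelyOpen (toLin snd) := by
  let i := (kernelFork ((prodBicone X Y).fst ≫ f - (prodBicone X Y).snd ≫ g)).ι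
  have w : (i ≫ (prodBicone X Y).fst) ≫ f = (i ≫ (prodBicone X Y).snd) ≫ g := by
    rw [← sub_eq_zero]
    simpa using (kernelFork ((prodBicone X Y).fst ≫ f - (prodBicone X Y).snd ≫ g)).condition
  have i_snd : IsCompletelyOpen (toLin (i ≫ (prodBicone X Y).snd)) :=
    hf.snd_comp_subtype (isCompletelyBounded_toLin g)
  rw [← h.lift_snd _ _ w] at i_snd
  exact i_snd.of_comp (isCompletelyBounded_toLin _)

theorem isExactCategory_Emax : IsExactCategory (Emax Op.{u}) where
  hasZeroObject := inferInstance
  hasBinaryProducts := inferInstance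
  isExactStructure :=
    { isKernelCokernelPair := fun _ h => h
      of_iso := fun _ _ ⟨e⟩ h => h.of_iso e
      id_mono := fun _ => (admissibleMono_Emax_iff _).2 .id
      id_epi := fun _ => (admissibleEpi_Emax_iff _).2 .id
      comp_mono := fun f g hf hg => (admissibleMono_Emax_iff _).2
        (((admissibleMono_Emax_iff g).1 hg).comp ((admissibleMono_Emax_iff f).1 hf))
      comp_epi := fun f g hf hg => (admissibleEpi_Emax_iff _).2
        (((admissibleEpi_Emax_iff g).1 hg).comp ((admissibleEpi_Emax_iff f).1 hf))
      pushout := fun f _ hf =>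
        have := hasPushouts_of_hasCokernels (C := Op.{u})
        ⟨inferInstance, fun _ _ h => (admissibleMono_Emax_iff _).2
          (isCompletelyBoundedBelow_of_isPushout h ((admissibleMono_Emax_iff f).1 hf))⟩
      pullback := fun f _ hf =>
        have := hasPullbacks_of_hasKernels (C := Op.{u})
        ⟨inferInstance, fun _ _ h => (admissibleEpi_Emax_iff _).2
          (isCompletelyOpen_of_isPullback h ((admissibleEpi_Emax_iff f).1 hf))⟩ }

end Op

/-! ### Operator modules -/

section OperatorModules

open Filter Topology TensorProduct

variable {H : Type*} [NormedAddCommGroup H] [InnerProductSpace ℂ H]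

lemma matrixToCLM_apply {n : ℕ} (a : Matrix (Fin n) (Fin n) (H →L[ℂ] H))
    (v : PiLp 2 fun _ : Fin n => H) (i : Fin n) : matrixToCLM a v i = ∑ j, a i j (v j) := by
  simp [matrixToCLM]

variable [CompleteSpace H] {A : OperatorAlgebra H} {n p : ℕ}

lemma rectNorm_alg_nonneg (y : Matrix (Fin n) (Fin p) A.alg) : 0 ≤ rectNorm y := norm_nonneg _

lemma rectNorm_alg_one_le (a : A.alg) : rectNorm (Matrix.of fun _ _ : Fin 1 => a) ≤ ‖a‖ := by
  refine ContinuousLinearMap.opNorm_le_bound _ (norm_nonneg a) fun v => ?_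
  have apply_eq : matrixToCLM ((corner (Matrix.of fun _ _ : Fin 1 => a)).map Subtype.val) v =
      PiLp.single 2 0 (a.1 (v 1)) := by
    have symm_zero : finSumFinEquiv.symm (0 : Fin (1 + 1)) = Sum.inl 0 := rfl
    have symm_one : finSumFinEquiv.symm (1 : Fin (1 + 1)) = Sum.inr 0 := rfl
    ext i
    fin_cases i <;> simp [matrixToCLM_apply, corner, Fin.sum_univ_two, symm_zero, symm_one]
  calc ‖matrixToCLM ((corner (Matrix.of fun _ _ : Fin 1 => a)).map Subtype.val) v‖
      = ‖a.1 (v 1)‖ := by rw [apply_eq, PiLp.norm_single]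
    _ ≤ ‖a.1‖ * ‖v 1‖ := a.1.le_opNorm _
    _ ≤ ‖a‖ * ‖v‖ := mul_le_mul_of_nonneg_left (PiLp.norm_apply_le v 1) (norm_nonneg _)

section MatAct

variable {E : Type*} [AddCommGroup E] [Module ℂ E] (act : E →ₗ[ℂ] A.alg →ₗ[ℂ] E)

/-- The product of a matrix over `E` and a matrix over `A` under a bilinear action: the image of
`matTensor x y` in `M_n(E)`. -/
def matAct (x : Matrix (Fin n) (Fin p) E) (y : Matrix (Fin p) (Fin n) A.alg) :
    Matrix (Fin n) (Fin n) E :=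
  Matrix.of fun i j => ∑ k, act (x i k) (y k j)

lemma map_lift_matTensor (x : Matrix (Fin n) (Fin p) E) (y : Matrix (Fin p) (Fin n) A.alg) :
    (matTensor x y).map (TensorProduct.lift act) = matAct act x y := by
  ext i j
  simp only [matTensor, matAct, Matrix.map_apply, Matrix.of_apply, map_sum, lift.tmul]

variable {act} in
lemma map_matAct {F : Type*} [AddCommGroup F] [Module ℂ F] {act' : F →ₗ[ℂ] A.alg →ₗ[ℂ] F}
    {f : E →ₗ[ℂ] F} (hf : ∀ x a, f (act x a) = act' (f x) a) (x : Matrix (Fin n) (Fin p) E)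
    (y : Matrix (Fin p) (Fin n) A.alg) :
    (matAct act x y).map f = matAct act' (x.map f) y := by
  ext i j
  simp only [matAct, Matrix.map_apply, Matrix.of_apply, map_sum, hf]

end MatAct

variable {E F : Type*} [NormedAddCommGroup E] [NormedSpace ℂ E] [OperatorSpace E]
  [NormedAddCommGroup F] [NormedSpace ℂ F] [OperatorSpace F]

lemma ofReal_mnorm_map_lift_le_haagerupNorm_iff (act : E →ₗ[ℂ] A.alg →ₗ[ℂ] E) :
    (∀ u : Matrix (Fin n) (Fin n) (E ⊗[ℂ] A.alg),
      ENNReal.ofReal (mnorm n (u.map (TensorProduct.lift act))) ≤ haagerupNorm u) ↔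
    ∀ (p : ℕ) (x : Matrix (Fin n) (Fin p) E) (y : Matrix (Fin p) (Fin n) A.alg),
      mnorm n (matAct act x y) ≤ rectNorm x * rectNorm y := by
  have rectNorm_mul_nonneg {p : ℕ} (x : Matrix (Fin n) (Fin p) E)
      (y : Matrix (Fin p) (Fin n) A.alg) : 0 ≤ rectNorm x * rectNorm y :=
    mul_nonneg (rectNorm_nonneg x) (rectNorm_alg_nonneg y)
  simp only [haagerupNorm, le_iInf_iff]
  refine ⟨fun h p x y => ?_, ?_⟩
  · rw [← ENNReal.ofReal_le_ofReal_iff (rectNorm_mul_nonneg x y), ← map_lift_matTensor]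
    exact h _ p x y rfl
  · rintro h _ p x y rfl
    rw [map_lift_matTensor]
    exact ENNReal.ofReal_le_ofReal (h p x y)

/-- An operator module from a bilinear action given by its matrix estimates, with pointwise
convergence along the contractive approximate units of `A` in place of non-degeneracy. -/
@[reducible]
def OperatorModule.ofTendsto (act : E →ₗ[ℂ] A.alg →ₗ[ℂ] E)
    (act_mul : ∀ (x : E) (a b : A.alg), act x (a * b) = act (act x a) b)
    (mnorm_matAct_le : ∀ (n p : ℕ) (x : Matrix (Fin n) (Fin p) E)
      (y : Matrix (Fin p) (Fin n) A.alg), mnorm n (matAct act x y) ≤ rectNorm x * rectNorm y)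
    (tendsto_act : ∀ l : Filter A.alg, l.IsApproximateUnit → (∀ᶠ e in l, ‖e‖ ≤ 1) →
      ∀ x, Tendsto (fun e => act x e) l (𝓝 x)) : OperatorModule A E where
  act := act
  act_mul := act_mul
  completelyContractive n :=
    (ofReal_mnorm_map_lift_le_haagerupNorm_iff act).2 (mnorm_matAct_le n)
  nondegenerate x := by
    obtain ⟨l, hl, hle⟩ := A.exists_cai
    have := hl.neBot
    exact mem_closure_of_tendsto (tendsto_act l hl hle x)
      (.of_forall fun e => Submodule.subset_span ⟨x, e, rfl⟩)

namespace OperatorModule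

variable [OperatorModule A E]

lemma mnorm_matAct_le (x : Matrix (Fin n) (Fin p) E) (y : Matrix (Fin p) (Fin n) A.alg) :
    mnorm n (matAct act x y) ≤ rectNorm x * rectNorm y :=
  (ofReal_mnorm_map_lift_le_haagerupNorm_iff act).1 (completelyContractive n) p x y

lemma norm_act_le (x : E) (a : A.alg) : ‖act x a‖ ≤ ‖x‖ * ‖a‖ := by
  have matAct_eq : matAct act (Matrix.of fun _ _ : Fin 1 => x) (Matrix.of fun _ _ => a) =
      Matrix.of fun _ _ => act x a := by
    ext
    exact Fintype.sum_unique fun _ : Fin 1 => act x a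
  calc ‖act x a‖
      ≤ rectNorm (Matrix.of fun _ _ : Fin 1 => x) * rectNorm (Matrix.of fun _ _ => a) := by
        rw [← mnorm_one, ← matAct_eq]
        exact mnorm_matAct_le _ _
    _ ≤ ‖x‖ * ‖a‖ := mul_le_mul ((rectNorm_le_mnorm _).trans_eq (mnorm_one x))
        (rectNorm_alg_one_le a) (rectNorm_alg_nonneg _) (norm_nonneg x)

lemma lipschitzWith_act_left (a : A.alg) : LipschitzWith ‖a‖₊ fun x : E => act x a :=
  AddMonoidHomClass.lipschitz_of_bound_nnnorm (act.flip a) _ fun x =>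
    (norm_act_le x a).trans_eq (mul_comm _ _)

lemma continuous_act_right (x : E) : Continuous fun a : A.alg => act x a :=
  AddMonoidHomClass.continuous_of_bound (act x) ‖x‖ (norm_act_le x)

variable {l : Filter A.alg}

lemma tendsto_act_of_mem_span (hl : l.IsApproximateUnit) {x : E}
    (hx : x ∈ Submodule.span ℂ {y : E | ∃ x, ∃ a : A.alg, y = act x a}) :
    Tendsto (fun e => act x e) l (𝓝 x) := by
  induction hx using Submodule.span_induction with
  | mem _ h =>
    obtain ⟨x, a, rfl⟩ := h
    simp only [← act_mul]
    exact ((continuous_act_right x).tendsto a).comp (hl.tendsto_mul_left a)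
  | zero => simpa only [map_zero, LinearMap.zero_apply] using tendsto_const_nhds
  | add x y _ _ hx hy => simpa only [map_add, LinearMap.add_apply] using hx.add hy
  | smul c x _ hx => simpa only [map_smul, LinearMap.smul_apply] using hx.const_smul c

lemma tendsto_act (hl : l.IsApproximateUnit) (hle : ∀ᶠ e in l, ‖e‖ ≤ 1) (x : E) :
    Tendsto (fun e => act x e) l (𝓝 x) := by
  -- The actions of the contractions in `A` are equicontinuous, so convergence need only be
  -- checked on a dense subset.
  have equicontinuous : Equicontinuous fun (e : {e : A.alg // ‖e‖ ≤ 1}) (x : E) => act x e.1 :=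
    (LipschitzWith.uniformEquicontinuous _ 1 fun e : {e : A.alg // ‖e‖ ≤ 1} =>
      (lipschitzWith_act_left e.1).weaken e.2).equicontinuous
  have tendsto_iff (x : E) : Tendsto (fun e : {e : A.alg // ‖e‖ ≤ 1} => act x e.1)
      (comap Subtype.val l) (𝓝 x) ↔ Tendsto (fun e => act x e) l (𝓝 x) :=
    tendsto_comap'_iff (by rwa [Subtype.range_coe_subtype])
  have isClosed := equicontinuous.isClosed_setOfPred_tendsto (l := comap Subtype.val l)
    continuous_id
  exact (tendsto_iff x).1 (closure_minimal
    (fun x hx => (tendsto_iff x).2 (tendsto_act_of_mem_span hl hx)) isClosed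
    (nondegenerate (A := A) x))

/-- A closed invariant subspace, as an operator module. -/
@[reducible]
noncomputable def ofSubmodule (K : Submodule ℂ E) [IsClosed (K : Set E)]
    (hK : ∀ x ∈ K, ∀ a : A.alg, act x a ∈ K) : OperatorModule A K :=
  ofTendsto
    (LinearMap.mk₂ ℂ (fun x a => ⟨act (x : E) a, hK x x.2 a⟩)
      (fun x y a => Subtype.ext (LinearMap.map_add₂ act x.1 y.1 a))
      (fun c x a => Subtype.ext (LinearMap.map_smul₂ act c x.1 a))
      (fun x a b => Subtype.ext (map_add (act x.1) a b))
      (fun c x a => Subtype.ext (map_smul (act x.1) c a)))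
    (fun x a b => Subtype.ext (act_mul x.1 a b))
    (fun n p x y => calc
      _ = mnorm n (matAct act (x.map K.subtype) y) := by
        rw [← mnorm_map_subtype, map_matAct]
        exact fun _ _ => rfl
      _ ≤ rectNorm (x.map K.subtype) * rectNorm y := mnorm_matAct_le _ y
      _ = rectNorm x * rectNorm y := by
        rw [rectNorm_eq_mnorm_corner x, ← mnorm_map_subtype]
        exact congrArg (fun z => mnorm _ z * _) (map_corner K.subtype.toAddMonoidHom x).symm)
    (fun _ hl hle x => tendsto_subtype_rng.2 (tendsto_act hl hle x.1))

/-- The action on the quotient by an invariant subspace. -/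
noncomputable def quotientAct (K : Submodule ℂ E) (hK : ∀ x ∈ K, ∀ a : A.alg, act x a ∈ K) :
    (E ⧸ K) →ₗ[ℂ] A.alg →ₗ[ℂ] (E ⧸ K) :=
  K.liftQ (act.compr₂ K.mkQ) fun x hx =>
    LinearMap.ext fun a => (Submodule.Quotient.mk_eq_zero K).2 (hK x hx a)

lemma mnorm_matAct_quotientAct_le {K : Submodule ℂ E}
    (hK : ∀ x ∈ K, ∀ a : A.alg, act x a ∈ K) (x : Matrix (Fin n) (Fin p) (E ⧸ K))
    (y : Matrix (Fin p) (Fin n) A.alg) :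
    mnorm n (matAct (quotientAct K hK) x y) ≤ rectNorm x * rectNorm y := by
  rw [mul_comm]
  refine le_mul_mnorm_quotient (rectNorm_alg_nonneg y) fun z hz => ?_
  let x' := z.submatrix (Fin.castAdd p) (Fin.natAdd n)
  have x_eq : x = x'.map K.mkQ := by
    rw [← Matrix.submatrix_map, hz]
    ext i j
    simp
  calc mnorm n (matAct (quotientAct K hK) x y)
      = mnorm n ((matAct act x' y).map K.mkQ) := by
        rw [x_eq, map_matAct]
        exact fun _ _ => rfl
    _ ≤ mnorm n (matAct act x' y) := mnorm_map_mkQ_le K _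
    _ ≤ rectNorm x' * rectNorm y := mnorm_matAct_le x' y
    _ ≤ mnorm (n + p) z * rectNorm y := mul_le_mul_of_nonneg_right
        (rectNorm_submatrix_castAdd_natAdd_le z) (rectNorm_alg_nonneg y)
    _ = rectNorm y * mnorm (n + p) z := mul_comm _ _

/-- The quotient by a closed invariant subspace, as an operator module. -/
@[reducible]
noncomputable def ofQuotient (K : Submodule ℂ E) [IsClosed (K : Set E)]
    (hK : ∀ x ∈ K, ∀ a : A.alg, act x a ∈ K) : OperatorModule A (E ⧸ K) :=
  ofTendsto (quotientAct K hK)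
    (fun x a b => by
      obtain ⟨x, rfl⟩ := K.mkQ_surjective x
      exact congrArg K.mkQ (act_mul x a b))
    (fun _ _ => mnorm_matAct_quotientAct_le hK)
    (fun _ hl hle => K.mkQ_surjective.forall.2 fun x =>
      (continuous_quot_mk.tendsto x).comp (tendsto_act hl hle x))

variable [OperatorModule A F]

variable (E F) in
/-- The componentwise action on a product. -/
noncomputable def prodAct : E × F →ₗ[ℂ] A.alg →ₗ[ℂ] E × F :=
  LinearMap.mk₂ ℂ (fun x a => (act x.1 a, act x.2 a))
    (fun x y a => Prod.ext (LinearMap.map_add₂ act x.1 y.1 a) (LinearMap.map_add₂ act x.2 y.2 a))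
    (fun c x a => Prod.ext (LinearMap.map_smul₂ act c x.1 a) (LinearMap.map_smul₂ act c x.2 a))
    (fun x a b => Prod.ext (map_add (act x.1) a b) (map_add (act x.2) a b))
    (fun c x a => Prod.ext (map_smul (act x.1) c a) (map_smul (act x.2) c a))

lemma rectNorm_prod (x : Matrix (Fin n) (Fin p) (E × F)) :
    rectNorm x = max (rectNorm (x.map (LinearMap.fst ℂ E F)))
      (rectNorm (x.map (LinearMap.snd ℂ E F))) := by
  rw [rectNorm_eq_mnorm_corner, mnorm_prod]
  exact congrArg₂ (fun a b => max (mnorm _ a) (mnorm _ b))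
    (map_corner (AddMonoidHom.fst E F) x) (map_corner (AddMonoidHom.snd E F) x)

lemma mnorm_matAct_prodAct_le (x : Matrix (Fin n) (Fin p) (E × F))
    (y : Matrix (Fin p) (Fin n) A.alg) :
    mnorm n (matAct (prodAct E F) x y) ≤ rectNorm x * rectNorm y := by
  rw [mnorm_prod, rectNorm_prod, max_mul_of_nonneg _ _ (rectNorm_alg_nonneg y),
    map_matAct (act' := act) (f := LinearMap.fst ℂ E F) fun _ _ => rfl,
    map_matAct (act' := act) (f := LinearMap.snd ℂ E F) fun _ _ => rfl]
  exact max_le_max (mnorm_matAct_le _ y) (mnorm_matAct_le _ y)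

noncomputable instance : OperatorModule A (E × F) :=
  ofTendsto (prodAct E F) (fun x a b => Prod.ext (act_mul x.1 a b) (act_mul x.2 a b))
    (fun _ _ => mnorm_matAct_prodAct_le)
    (fun _ hl hle x => (tendsto_act hl hle x.1).prodMk_nhds (tendsto_act hl hle x.2))

noncomputable instance : OperatorModule A PUnit.{u + 1} :=
  ofTendsto 0 (fun _ _ _ => rfl)
    (fun _ _ x y => mul_nonneg (rectNorm_nonneg x) (rectNorm_alg_nonneg y))
    (fun _ _ _ _ => tendsto_const_nhds)

end OperatorModule

end OperatorModules

/-! ### The category of operator modules -/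

namespace OMod

open OperatorModule

variable {H : Type w} [NormedAddCommGroup H] [InnerProductSpace ℂ H] [CompleteSpace H]
  {A : OperatorAlgebra H}

/-- The linear map underlying a morphism of operator modules. -/
def toLin {X Y : OMod.{u} A} (f : X ⟶ Y) : X.carrier →ₗ[ℂ] Y.carrier := Subtype.val f

/-- A completely bounded module map as a morphism of operator modules. -/
def ofHom {X Y : OMod.{u} A} (f : X.carrier →ₗ[ℂ] Y.carrier) (hf : IsCompletelyBounded f)
    (hact : ∀ (x : X.carrier) (a : A.alg), f (act x a) = act (f x) a) : X ⟶ Y :=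
  ⟨f, hf, hact⟩

variable {X Y Z : OMod.{u} A}

lemma toLin_act (f : X ⟶ Y) (x : X.carrier) (a : A.alg) :
    toLin f (act x a) = act (toLin f x) a :=
  (Subtype.property f).2 x a

lemma hom_ext {f g : X ⟶ Y} (h : toLin f = toLin g) : f = g := Subtype.ext h

instance : (forget.{u} A).Faithful where
  map_injective h := hom_ext (congrArg Op.toLin h)

lemma exists_map_eq_of_injective {i : Y ⟶ Z} (hi : Function.Injective (toLin i)) (k : X ⟶ Z)
    {l : (forget A).obj X ⟶ (forget A).obj Y}
    (hl : l ≫ (forget A).map i = (forget A).map k) : ∃ l' : X ⟶ Y, (forget A).map l' = l := by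
  let φ : X.carrier →ₗ[ℂ] Y.carrier := Op.toLin l
  have apply_φ (x : X.carrier) : toLin i (φ x) = toLin k x :=
    LinearMap.congr_fun (congrArg Op.toLin hl) x
  refine ⟨ofHom φ (Op.isCompletelyBounded_toLin l) fun x a => hi ?_, rfl⟩
  rw [toLin_act, apply_φ, apply_φ, toLin_act]

lemma exists_map_eq_of_surjective {p : X ⟶ Y} (hp : Function.Surjective (toLin p)) (k : X ⟶ Z)
    {l : (forget A).obj Y ⟶ (forget A).obj Z}
    (hl : (forget A).map p ≫ l = (forget A).map k) : ∃ l' : Y ⟶ Z, (forget A).map l' = l := by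
  let φ : Y.carrier →ₗ[ℂ] Z.carrier := Op.toLin l
  have apply_φ (x : X.carrier) : φ (toLin p x) = toLin k x :=
    LinearMap.congr_fun (congrArg Op.toLin hl) x
  refine ⟨ofHom φ (Op.isCompletelyBounded_toLin l) (hp.forall.2 fun x a => ?_), rfl⟩
  rw [← toLin_act, apply_φ, apply_φ, toLin_act]

instance : (forget.{u} A).ReflectsIsomorphisms where
  reflects {X Y} f hf := by
    obtain ⟨g, hfg, hgf⟩ := hf
    have injective : Function.Injective (toLin f) :=
      Function.LeftInverse.injective (g := Op.toLin g)
        (LinearMap.congr_fun (congrArg Op.toLin hfg))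
    obtain ⟨g, rfl⟩ := exists_map_eq_of_injective injective (𝟙 Y) hgf
    exact ⟨g, (forget A).map_injective hfg, (forget A).map_injective hgf⟩

lemma act_mem_ker (f : X ⟶ Y) :
    ∀ x ∈ LinearMap.ker (toLin f), ∀ a : A.alg, act x a ∈ LinearMap.ker (toLin f) := by
  intro x hx a
  rw [LinearMap.mem_ker] at hx ⊢
  rw [toLin_act, hx, map_zero, LinearMap.zero_apply]

lemma act_mem_closure_range (f : X ⟶ Y) :
    ∀ y ∈ (LinearMap.range (toLin f)).topologicalClosure, ∀ a : A.alg,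
      act y a ∈ (LinearMap.range (toLin f)).topologicalClosure := by
  intro y hy a
  refine map_mem_closure (f := fun y => act y a) (lipschitzWith_act_left a).continuous hy ?_
  rintro _ ⟨x, rfl⟩
  exact ⟨act x a, toLin_act f x a⟩

instance (f : X ⟶ Y) : IsClosed (LinearMap.ker (toLin f) : Set X.carrier) :=
  (Op.isCompletelyBounded_toLin ((forget A).map f)).isClosed_ker

instance (f : X ⟶ Y) :
    IsClosed ((LinearMap.range (toLin f)).topologicalClosure : Set Y.carrier) :=
  Submodule.isClosed_topologicalClosure _

/-- The kernel of a module map, as an invariant subspace. -/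
noncomputable def kernelFork (f : X ⟶ Y) : KernelFork f :=
  letI := ofSubmodule (LinearMap.ker (toLin f)) (act_mem_ker f)
  KernelFork.ofι (ofHom (X := ⟨LinearMap.ker (toLin f)⟩) (LinearMap.ker (toLin f)).subtype
    (isCompletelyBounded_subtype _) fun _ _ => rfl) (hom_ext (LinearMap.comp_ker_subtype _))

lemma nonempty_isLimit (f : X ⟶ Y) : Nonempty (IsLimit (kernelFork f)) := by
  have injective : Function.Injective (toLin (kernelFork f).ι) :=
    (LinearMap.ker (toLin f)).injective_subtype
  have : Mono (kernelFork f).ι := (forget A).mono_of_mono_map (Op.mono_of_injective injective)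
  have exists_lift {W : OMod.{u} A} (k : W ⟶ X) (hk : k ≫ f = 0) :
      ∃ l, l ≫ (kernelFork f).ι = k := by
    obtain ⟨hι⟩ := Op.nonempty_isLimit ((forget A).map f)
    obtain ⟨l, hl⟩ := KernelFork.IsLimit.lift' hι ((forget A).map k)
      (by rw [← Functor.map_comp, hk, Functor.map_zero])
    obtain ⟨l, rfl⟩ := exists_map_eq_of_injective injective k hl
    exact ⟨l, (forget A).map_injective hl⟩
  choose l hl using @exists_lift
  exact ⟨KernelFork.IsLimit.ofι' (kernelFork f).ι (kernelFork f).condition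
    fun k hk => ⟨l k hk, hl k hk⟩⟩

/-- The cokernel of a module map: the quotient by the closure of its range. -/
noncomputable def cokernelCofork (f : X ⟶ Y) : CokernelCofork f :=
  letI := ofQuotient (LinearMap.range (toLin f)).topologicalClosure (act_mem_closure_range f)
  CokernelCofork.ofπ (ofHom (Y := ⟨Y.carrier ⧸ (LinearMap.range (toLin f)).topologicalClosure⟩)
      (LinearMap.range (toLin f)).topologicalClosure.mkQ (isCompletelyBounded_mkQ _)
      fun _ _ => rfl)
    ((forget A).map_injective (Op.cokernelCofork ((forget A).map f)).condition)

lemma nonempty_isColimit (f : X ⟶ Y) : Nonempty (IsColimit (cokernelCofork f)) := by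
  have surjective : Function.Surjective (toLin (cokernelCofork f).π) :=
    Submodule.mkQ_surjective _
  have : Epi (cokernelCofork f).π := (forget A).epi_of_epi_map (Op.epi_of_surjective surjective)
  have exists_desc {W : OMod.{u} A} (k : Y ⟶ W) (hk : f ≫ k = 0) :
      ∃ l, (cokernelCofork f).π ≫ l = k := by
    obtain ⟨hπ⟩ := Op.nonempty_isColimit ((forget A).map f)
    obtain ⟨l, hl⟩ := CokernelCofork.IsColimit.desc' hπ ((forget A).map k)
      (by rw [← Functor.map_comp, hk, Functor.map_zero])
    obtain ⟨l, rfl⟩ := exists_map_eq_of_surjective surjective k hl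
    exact ⟨l, (forget A).map_injective hl⟩
  choose l hl using @exists_desc
  exact ⟨CokernelCofork.IsColimit.ofπ' (cokernelCofork f).π (cokernelCofork f).condition
    fun k hk => ⟨l k hk, hl k hk⟩⟩

instance : HasKernels (OMod.{u} A) := ⟨fun f => ⟨_, (nonempty_isLimit f).some⟩⟩

instance : HasCokernels (OMod.{u} A) := ⟨fun f => ⟨_, (nonempty_isColimit f).some⟩⟩

instance : HasZeroObject (OMod.{u} A) :=
  ⟨⟨PUnit⟩, (IsZero.iff_id_eq_zero _).2 (hom_ext (LinearMap.ext fun _ => rfl))⟩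

/-- The product of two operator modules as a biproduct. -/
noncomputable def prodBicone (X Y : OMod.{u} A) : BinaryBicone X Y where
  pt := ⟨X.carrier × Y.carrier⟩
  fst := ofHom (LinearMap.fst ℂ _ _) isCompletelyBounded_fst fun _ _ => rfl
  snd := ofHom (LinearMap.snd ℂ _ _) isCompletelyBounded_snd fun _ _ => rfl
  inl := ofHom (LinearMap.inl ℂ _ _) (.prod (id_mem_CB _) (CB _ _).zero_mem) fun _ a =>
    Prod.ext rfl (LinearMap.map_zero₂ act a).symm
  inr := ofHom (LinearMap.inr ℂ _ _) (.prod (CB _ _).zero_mem (id_mem_CB _)) fun _ a =>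
    Prod.ext (LinearMap.map_zero₂ act a).symm rfl

instance : HasBinaryBiproducts (OMod.{u} A) where
  has_binary_biproduct X Y := hasBinaryBiproduct_of_total (prodBicone X Y)
    (hom_ext (LinearMap.ext fun x => Prod.ext (add_zero x.1) (zero_add x.2)))

instance (f : X ⟶ Y) : PreservesLimit (parallelPair f 0) (forget A) :=
  preservesLimit_of_preserves_limit_cone (nonempty_isLimit f).some
    (((kernelFork f).isLimitMapConeEquiv _).symm (Op.nonempty_isLimit ((forget A).map f)).some)

instance (f : X ⟶ Y) : PreservesColimit (parallelPair f 0) (forget A) :=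
  preservesColimit_of_preserves_colimit_cocone (nonempty_isColimit f).some
    (((cokernelCofork f).isColimitMapCoconeEquiv _).symm
      (Op.nonempty_isColimit ((forget A).map f)).some)

end OMod

lemma Erel_eq_relativeClass {H : Type w} [NormedAddCommGroup H] [InnerProductSpace ℂ H]
    [CompleteSpace H] (A : OperatorAlgebra H) :
    Erel.{u} A = relativeClass (forget A) (Emax (OMod A)) (Emin Op) :=
  funext fun _ => propext
    ⟨fun ⟨h, ⟨s⟩⟩ => ⟨h, Emin_of_splitting s⟩, fun ⟨h, h'⟩ => ⟨h, h'.2⟩⟩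

end OpMod

theorem mainTheorem4 {H : Type w} [NormedAddCommGroup H] [InnerProductSpace ℂ H]
    [CompleteSpace H] (A : OpMod.OperatorAlgebra H) :
    OpMod.IsExactCategory (OpMod.Erel.{u} A) ∧
    OpMod.IsExactFunctor (OpMod.forget.{u} A)
      (OpMod.Emax (OpMod.OMod.{u} A)) (OpMod.Emax OpMod.Op.{u}) ∧
    OpMod.IsExactCategory (OpMod.Emin OpMod.Op.{u}) ∧
    OpMod.Erel.{u} A = OpMod.relativeClass (OpMod.forget.{u} A)
      (OpMod.Emax (OpMod.OMod.{u} A)) (OpMod.Emin OpMod.Op.{u}) := by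
  have exact_Emax := OpMod.Op.isExactCategory_Emax.{u}
  have exact_Emin := OpMod.isExactCategory_Emin OpMod.Op.{u}
  have Emax_eq := OpMod.Emax_eq_inverseImage (OpMod.forget.{u} A)
  have Erel_eq := OpMod.Erel_eq_relativeClass.{u} A
  refine ⟨?_, ⟨?_, exact_Emax, Emax_eq.le⟩, exact_Emin, Erel_eq⟩
  · rw [Erel_eq, OpMod.relativeClass_Emax_eq_inverseImage _ fun _ h => h.1]
    exact OpMod.isExactCategory_inverseImage _ exact_Emin.isExactStructure
  · rw [Emax_eq]
    exact OpMod.isExactCategory_inverseImage _ exact_Emax.isExactStructure
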